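/- There is a universal constant $\alpha\ge 1$, and for every $\epsilon>0$ there are a constant $K=K(\epsilon)$ and, for all $R,r>0$, a constant $c=c(\epsilon,R,r)$, such that the following holds. Let $S$ be a closed Riemann surface of genus $g\ge 2$ whose injectivity radius, with respect to its hyperbolic metric $\rho_S(z)\,|dz|$ of curvature $-1$, is at least $\epsilon$. Let $Q(S)$ be the space of holomorphic quadratic differentials $\varphi(z)\,dz^2$ on $S$, with the norm $\|\varphi\|_{Q(S)}=\sup_{z\in S}\rho_S(z)^{-2}|\varphi(z)|$ and the distance $\|\varphi-\psi\|_{Q(S)}$. For $E\subset Q(S)$ let $\eta_{Q(S)}(E,r)$ be the minimal number of open balls of radius $r$, with centres in $Q(S)$, needed to cover $E$, and let $B_{Q(S)}(0,R)$ be the open ball of radius $R$ about $0$. Then there is a natural number $n\le Kg$, depending only on $S$, such that for all $R,r>0$ $$\eta_{Q(S)}\bigl(B_{Q(S)}(0,R),r\bigr)\le\left(\frac{4\sqrt2\,\alpha^2R}{r}+2\right)^{2n}\qquad\text{and}\qquad \eta_{Q(S)}\bigl(B_{Q(S)}(0,R),r\bigr)\le c(\epsilon,R,r)^{\,g}.$$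 -/

import Mathlib

open scoped Manifold UpperHalfPlane NNReal ENNReal

noncomputable section

/-! ### Covering numbers -/

/-- The `r`-covering number of `E` in `X`: the minimal number of open balls of radius `r`, with
centres in `X`, needed to cover `E` (and `⊤` if no finite number suffices). -/
def coveringNumber {X : Type*} [PseudoEMetricSpace X] (E : Set X) (r : ℝ) : ℕ∞ :=
  ⨅ (T : Set X) (_ : E ⊆ ⋃ x ∈ T, Metric.eball x (ENNReal.ofReal r)), T.encard

/-! ### The closed orientable topological surface of genus `g` -/

/-- The boundary of the closed unit disc, seen as a polygon with `4 * g` sides: for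
`k = 0, …, 4 * g - 1` the `k`-th side is run through by `polygonBoundary g (k + t)`,
`0 ≤ t ≤ 1`. -/
def polygonBoundary (g : ℕ) (s : ℝ) : Metric.closedBall (0 : ℂ) 1 :=
  ⟨Complex.exp ((2 * Real.pi * s / (4 * g) : ℝ) * Complex.I), by
    rw [mem_closedBall_zero_iff, Complex.norm_exp_ofReal_mul_I]⟩

/-- The side pairing of the `4 * g`-gon with boundary word
`a₁ b₁ a₁⁻¹ b₁⁻¹ ⋯ a_g b_g a_g⁻¹ b_g⁻¹`. -/
inductive SidePairing (g : ℕ) :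
    Metric.closedBall (0 : ℂ) 1 → Metric.closedBall (0 : ℂ) 1 → Prop
  | a (j : ℕ) (hj : j < g) (t : ℝ) (ht : t ∈ Set.Icc (0 : ℝ) 1) :
      SidePairing g (polygonBoundary g (4 * j + t)) (polygonBoundary g (4 * j + 3 - t))
  | b (j : ℕ) (hj : j < g) (t : ℝ) (ht : t ∈ Set.Icc (0 : ℝ) 1) :
      SidePairing g (polygonBoundary g (4 * j + 1 + t)) (polygonBoundary g (4 * j + 4 - t))

/-- The closed orientable surface of genus `g ≥ 1`: the quotient space of the `4 * g`-gon by the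
equivalence relation generated by the side pairing. -/
def ModelSurface (g : ℕ) : Type := Quot (SidePairing g)

instance (g : ℕ) : TopologicalSpace (ModelSurface g) :=
  inferInstanceAs (TopologicalSpace (Quot (SidePairing g)))

/-- `S` is a closed (orientable) surface of genus `g ≥ 1`. -/
def HasGenus (S : Type*) [TopologicalSpace S] (g : ℕ) : Prop :=
  Nonempty (S ≃ₜ ModelSurface g)

/-! ### The hyperbolic metric of a Riemann surface -/

section RiemannSurface

variable {S : Type*} [TopologicalSpace S] [ChartedSpace ℂ S]

/-- `p` is a holomorphic covering map of `S` by the upper half-plane. As `ℍ` is simply connected,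
it is a universal covering, and any two such `p` for the same connected `S` differ by a
biholomorphic map of `ℍ`, which is an isometry of the hyperbolic metric. The Riemann surfaces that
have such a `p` are the hyperbolic ones; among them are all closed ones of genus at least `2`. -/
def IsHolomorphicCovering (p : ℍ → S) : Prop :=
  IsCoveringMap p ∧ MDifferentiable 𝓘(ℂ) 𝓘(ℂ) p

/-- The density `ρ_S` at the point `z` of the local coordinate `e` of the hyperbolic metric
`ρ_S(z) |dz|` of curvature `-1` of a hyperbolic Riemann surface. It is the metric that a
holomorphic covering `p` pulls back to the hyperbolic metric `|dτ| / Im τ` of `ℍ`, that is,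
`ρ_S(e (p τ)) * |(e ∘ p)' τ| = 1 / Im τ`. All `p` and all `τ` over the point in question give the
same value, so that the infimum is that common value. -/
def hyperbolicDensity (e : OpenPartialHomeomorph S ℂ) (z : ℂ) : ℝ≥0∞ :=
  ⨅ (p : ℍ → S) (_ : IsHolomorphicCovering p) (τ : ℍ) (_ : p τ = e.symm z),
    (ENNReal.ofReal (τ.im * ‖deriv (fun w : ℂ => e (p (UpperHalfPlane.ofComplex w))) τ‖))⁻¹

variable (S) in
/-- The injectivity radius of a hyperbolic Riemann surface for its hyperbolic metric: the supremum
of the radii `s` such that a holomorphic covering by `ℍ` (equivalently, the exponential map at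
each point) is injective on all open hyperbolic discs of radius `s`. It is independent of the
covering. -/
def injectivityRadius : ℝ≥0∞ :=
  ⨆ (s : ℝ≥0) (_ : ∃ p : ℍ → S, IsHolomorphicCovering p ∧
    ∀ τ : ℍ, Set.InjOn p (Metric.ball τ (s : ℝ))), (s : ℝ≥0∞)

/-! ### The Bers space -/

variable (S) in
/-- Holomorphic quadratic differentials `φ(z) dz²` on `S`: a holomorphic function `φ e` on
`e.target` for every chart `e` (with the value `0` outside `e.target`), such that
`φ e z = φ e' (h z) * (h' z) ^ 2` for the transition map `h = e' ∘ e⁻¹` between two charts. -/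
def quadraticDifferentials : Submodule ℂ (atlas ℂ S → ℂ → ℂ) where
  carrier := {φ |
    (∀ e : atlas ℂ S, DifferentiableOn ℂ (φ e) e.1.target) ∧
    (∀ e : atlas ℂ S, ∀ z ∉ e.1.target, φ e z = 0) ∧
    (∀ e e' : atlas ℂ S, ∀ z ∈ (e.1.symm.trans e'.1).source,
      φ e z = φ e' (e'.1 (e.1.symm z)) * (deriv (fun w : ℂ => e'.1 (e.1.symm w)) z) ^ 2)}
  zero_mem' := by
    refine ⟨fun e => ?_, fun e z _ => rfl, fun e e' z _ => ?_⟩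
    · exact differentiableOn_const 0
    · simp
  add_mem' := by
    rintro φ ψ ⟨h1, h2, h3⟩ ⟨k1, k2, k3⟩
    refine ⟨fun e => (h1 e).add (k1 e), fun e z hz => ?_, fun e e' z hz => ?_⟩
    · simp [h2 e z hz, k2 e z hz]
    · simp only [Pi.add_apply, h3 e e' z hz, k3 e e' z hz, add_mul]
  smul_mem' := by
    rintro a φ ⟨h1, h2, h3⟩
    refine ⟨fun e => (h1 e).const_smul a, fun e z hz => ?_, fun e e' z hz => ?_⟩
    · simp [h2 e z hz]
    · simp only [Pi.smul_apply, smul_eq_mul, h3 e e' z hz, mul_assoc]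

variable (S) in
/-- The Bers space `Q(S)` of a closed hyperbolic Riemann surface: the complex vector space of
holomorphic quadratic differentials on `S`. -/
def BersSpace : Type _ := quadraticDifferentials S

instance : AddCommGroup (BersSpace S) := inferInstanceAs (AddCommGroup (quadraticDifferentials S))

instance : Module ℂ (BersSpace S) := inferInstanceAs (Module ℂ (quadraticDifferentials S))

/-- The local expression of a quadratic differential in the chart `e`. -/
def BersSpace.coeff (φ : BersSpace S) (e : atlas ℂ S) (z : ℂ) : ℂ := φ.1 e z

/-- The norm `‖φ‖ = sup_z ρ_S(z)⁻² |φ(z)|` of the Bers space. It takes values in `[0, ∞]`, and is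
finite on closed hyperbolic surfaces. -/
def bersNorm (φ : BersSpace S) : ℝ≥0∞ :=
  ⨆ (e : atlas ℂ S) (z : ℂ) (_ : z ∈ e.1.target),
    ‖φ.coeff e z‖ₑ / (hyperbolicDensity e.1 z) ^ 2

/-- The distance of the Bers space, `d(φ, ψ) = ‖φ - ψ‖`. -/
instance : PseudoEMetricSpace (BersSpace S) where
  edist φ ψ := bersNorm (φ - ψ)
  edist_self φ := by
    have h : ∀ (e : atlas ℂ S) (z : ℂ), (0 : BersSpace S).coeff e z = 0 := fun _ _ => rfl
    simp [bersNorm, h]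
  edist_comm φ ψ := by
    have h : ∀ (e : atlas ℂ S) (z : ℂ), (φ - ψ).coeff e z = -(ψ - φ).coeff e z := fun e z =>
      (neg_sub (ψ.coeff e z) (φ.coeff e z)).symm
    simp only [bersNorm, h, enorm_neg]
  edist_triangle φ ψ χ := by
    refine iSup_le fun e => iSup_le fun z => iSup_le fun hz => ?_
    have h : (φ - χ).coeff e z = (φ - ψ).coeff e z + (ψ - χ).coeff e z :=
      (sub_add_sub_cancel (φ.coeff e z) (ψ.coeff e z) (χ.coeff e z)).symm
    have key : ∀ θ : BersSpace S,
        ‖θ.coeff e z‖ₑ / (hyperbolicDensity e.1 z) ^ 2 ≤ bersNorm θ := fun θ =>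
      le_iSup_of_le e (le_iSup_of_le z (le_iSup_of_le hz le_rfl))
    calc ‖(φ - χ).coeff e z‖ₑ / (hyperbolicDensity e.1 z) ^ 2
        ≤ (‖(φ - ψ).coeff e z‖ₑ + ‖(ψ - χ).coeff e z‖ₑ) / (hyperbolicDensity e.1 z) ^ 2 := by
          rw [h]; gcongr; exact enorm_add_le _ _
      _ = ‖(φ - ψ).coeff e z‖ₑ / (hyperbolicDensity e.1 z) ^ 2
          + ‖(ψ - χ).coeff e z‖ₑ / (hyperbolicDensity e.1 z) ^ 2 := ENNReal.add_div
      _ ≤ bersNorm (φ - ψ) + bersNorm (ψ - χ) := add_le_add (key _) (key _)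

end RiemannSurface

end

section

open Complex Metric Set Topology Filter

/-! ### Winding numbers of loops in the punctured plane -/

/-! By comparison of volumes, a ball of radius R in a d-dimensional real space with a seminorm
contains at most (2R/r + 1)^d points at mutual distance at least r
(`card_le_of_separated_of_extended_seminorm_lt`), and a largest such set gives the centres of a
cover (`coveringNumber_le_of_separated`). Everything therefore rests on a bound for dim Q(S) linear
in g; here it is 4g over ℂ, so that n = 4g and α = 1 suffice.

The dimension bound holds because a nonzero φ has fewer than 4g distinct zeros
(`IsHolomorphicCovering.card_zeros_lt`), which makes evaluation at 4g points injective. The zeros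
are counted by a topological argument principle. Positive injectivity radius provides a holomorphic
covering p : ℍ → S, through which the 4g-gon lifts to ℍ; a homeomorphism of S first moves the zeros
off the sides. Along the lifted boundary the pullback of φ has a winding number at least the number
of zeros in absolute value (`card_zeros_le_abs_windingNumber`): each zero contributes its
multiplicity times the degree of the lifted polygon, which is odd and so nonzero.

Conversely, lifts of paired sides differ by a deck transformation γ, which changes the pullback by
the factor γ'². As γ is a Möbius map, the argument of γ'² varies by less than 4π
(`exists_log_deriv_sq_automorphism`). In each block a b a⁻¹ b⁻¹ all else cancels, so the 2g pairs
give a total change of argument below 8πg, that is, a winding number below 4g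
(`abs_windingNumber_lt_of_paired_sides`). -/

theorem exists_continuous_log {X : Type*} [TopologicalSpace X] [SimplyConnectedSpace X]
    [LocallyPathConnectedSpace X] {u : X → ℂ} (hu : Continuous u) (h0 : ∀ x, u x ≠ 0) :
    ∃ ℓ : X → ℂ, Continuous ℓ ∧ ∀ x, exp (ℓ x) = u x := by
  obtain ⟨x₀⟩ := (inferInstance : Nonempty X)
  obtain ⟨ℓ, ⟨-, hℓ⟩, -⟩ := isCoveringMapOn_exp.existsUnique_continuousMap_lifts ⟨u, hu⟩
    (a₀ := x₀) (exp_log (h0 x₀)) h0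
  exact ⟨ℓ, ℓ.continuous, fun x => congrFun hℓ x⟩

/-- Two continuous logarithms of one function, shifted to agree at a point, are lifts through the
covering `exp` and so agree everywhere. -/
theorem sub_eq_sub_of_exp_eq {X : Type*} [TopologicalSpace X] [PreconnectedSpace X]
    {ℓ₁ ℓ₂ : X → ℂ} (h₁ : Continuous ℓ₁) (h₂ : Continuous ℓ₂)
    (h : ∀ x, exp (ℓ₁ x) = exp (ℓ₂ x)) (x y : X) : ℓ₁ x - ℓ₂ x = ℓ₁ y - ℓ₂ y := by
  have hy : exp (ℓ₁ y - ℓ₂ y) = 1 := by rw [exp_sub, h, div_self (exp_ne_zero _)]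
  have := isCoveringMap_exp.eq_of_comp_eq h₁ (h₂.add (continuous_const (y := ℓ₁ y - ℓ₂ y)))
    (by ext z; simp [exp_add, hy, h]) y (by simp)
  have h' : ℓ₁ x = ℓ₂ x + (ℓ₁ y - ℓ₂ y) := congrFun this x
  rw [h']; ring

/-- The path `u` on `[0, 1]` has a continuous logarithm whose increment is `2πi n`. -/
def HasWindingNumber (u : ℝ → ℂ) (n : ℤ) : Prop :=
  ∃ ℓ : ℝ → ℂ, Continuous ℓ ∧ (∀ s, exp (ℓ s) = u s) ∧ ℓ 1 - ℓ 0 = n * (2 * Real.pi * I)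

/-- The standard parametrization of the unit circle by `[0, 1]`. -/
noncomputable def unitCircle (s : ℝ) : ℂ := exp ((2 * Real.pi * s : ℝ) * I)

theorem continuous_unitCircle : Continuous unitCircle := by unfold unitCircle; fun_prop

@[simp] theorem norm_unitCircle (s : ℝ) : ‖unitCircle s‖ = 1 := norm_exp_ofReal_mul_I _

theorem unitCircle_one : unitCircle 1 = unitCircle 0 := by
  simp [unitCircle]

theorem unitCircle_add_half (s : ℝ) : unitCircle (s + 1 / 2) = -unitCircle s := by
  unfold unitCircle
  rw [← exp_add_pi_mul_I]
  congr 1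
  push_cast
  ring

namespace HasWindingNumber

theorem exists_of_continuous {u : ℝ → ℂ} (hu : Continuous u) (h0 : ∀ s, u s ≠ 0)
    (h1 : u 1 = u 0) : ∃ n, HasWindingNumber u n := by
  obtain ⟨ℓ, hℓ, hexp⟩ := exists_continuous_log hu h0
  obtain ⟨n, hn⟩ := exp_eq_exp_iff_exists_int.1 ((hexp 1).trans (h1.trans (hexp 0).symm))
  exact ⟨n, ℓ, hℓ, hexp, by rw [hn]; ring⟩

theorem unique {u : ℝ → ℂ} {m n : ℤ} (hm : HasWindingNumber u m) (hn : HasWindingNumber u n) :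
    m = n := by
  obtain ⟨ℓ₁, h₁, e₁, d₁⟩ := hm
  obtain ⟨ℓ₂, h₂, e₂, d₂⟩ := hn
  have h := sub_eq_sub_of_exp_eq h₁ h₂ (fun s => (e₁ s).trans (e₂ s).symm) 1 0
  have : (m : ℂ) * (2 * Real.pi * I) = n * (2 * Real.pi * I) := by
    rw [← d₁, ← d₂]; linear_combination h
  exact_mod_cast mul_right_cancel₀ two_pi_I_ne_zero this

theorem mul {u v : ℝ → ℂ} {m n : ℤ} (hu : HasWindingNumber u m) (hv : HasWindingNumber v n) :
    HasWindingNumber (fun s => u s * v s) (m + n) := by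
  obtain ⟨ℓ₁, h₁, e₁, d₁⟩ := hu
  obtain ⟨ℓ₂, h₂, e₂, d₂⟩ := hv
  refine ⟨fun s => ℓ₁ s + ℓ₂ s, h₁.add h₂, fun s => by rw [exp_add, e₁, e₂], ?_⟩
  push_cast
  linear_combination d₁ + d₂

theorem pow {u : ℝ → ℂ} {m : ℤ} (hu : HasWindingNumber u m) (k : ℕ) :
    HasWindingNumber (fun s => u s ^ k) (k * m) := by
  obtain ⟨ℓ, h, e, d⟩ := hu
  refine ⟨fun s => k * ℓ s, by fun_prop, fun s => by rw [exp_nat_mul, e], ?_⟩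
  push_cast
  linear_combination (k : ℂ) * d

theorem prod {ι : Type*} (Z : Finset ι) {u : ι → ℝ → ℂ} {m : ι → ℤ}
    (h : ∀ a ∈ Z, HasWindingNumber (u a) (m a)) :
    HasWindingNumber (fun s => ∏ a ∈ Z, u a s) (∑ a ∈ Z, m a) := by
  classical
  induction Z using Finset.induction_on with
  | empty => exact ⟨fun _ => 0, continuous_const, by simp, by simp⟩
  | insert a Z ha ih =>
    simp only [Finset.prod_insert ha, Finset.sum_insert ha]
    exact (h a (by simp)).mul (ih fun b hb => h b (by simp [hb]))

/-- A logarithm on the whole plane restricts to both loops, and its increment from s = 0 to s = 1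
does not depend on t because `H` closes up. -/
theorem of_homotopy {H : ℝ × ℝ → ℂ} (hH : Continuous H) (h0 : ∀ x, H x ≠ 0)
    (h1 : ∀ t, H (1, t) = H (0, t)) {n : ℤ} {a : ℝ} (hn : HasWindingNumber (fun s => H (s, a)) n)
    (b : ℝ) : HasWindingNumber (fun s => H (s, b)) n := by
  obtain ⟨ℓ, hℓ, hexp⟩ := exists_continuous_log hH h0
  have key := sub_eq_sub_of_exp_eq (ℓ₁ := fun t => ℓ (1, t)) (ℓ₂ := fun t => ℓ (0, t))
    (by fun_prop) (by fun_prop) (fun t => by rw [hexp, hexp, h1]) a b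
  obtain ⟨k, hk⟩ := exp_eq_exp_iff_exists_int.1
    ((hexp (1, b)).trans ((h1 b).trans (hexp (0, b)).symm))
  have hb : HasWindingNumber (fun s => H (s, b)) k :=
    ⟨fun s => ℓ (s, b), by fun_prop, fun s => hexp _, by simp only [hk]; ring⟩
  have ha : HasWindingNumber (fun s => H (s, a)) k :=
    ⟨fun s => ℓ (s, a), by fun_prop, fun s => hexp _, by rw [key, hk]; ring⟩
  rwa [hn.unique ha]

theorem comp_unitCircle {u : ℂ → ℂ} (hu : Continuous u) (h0 : ∀ z, u z ≠ 0) :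
    HasWindingNumber (fun s => u (unitCircle s)) 0 := by
  obtain ⟨ℓ, hℓ, hexp⟩ := exists_continuous_log hu h0
  exact ⟨fun s => ℓ (unitCircle s), hℓ.comp continuous_unitCircle, fun s => hexp _,
    by simp [unitCircle_one]⟩

/-- The logarithm gains the same odd multiple of πi on each half of the loop. -/
theorem odd {u : ℝ → ℂ} {n : ℤ} (hn : HasWindingNumber u n)
    (hu : ∀ s, u (s + 1 / 2) = -u s) : Odd n := by
  obtain ⟨ℓ, h, e, d⟩ := hn
  have key := sub_eq_sub_of_exp_eq (ℓ₁ := fun s => ℓ (s + 1 / 2))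
    (ℓ₂ := fun s => ℓ s + Real.pi * I) (by fun_prop) (by fun_prop)
    (fun s => by rw [exp_add_pi_mul_I, e, e, hu]) 0 (1 / 2)
  obtain ⟨k, hk⟩ := exp_eq_exp_iff_exists_int.1
    (show exp (ℓ (1 / 2)) = exp (ℓ 0 + Real.pi * I) by
      rw [exp_add_pi_mul_I, e, e, ← hu]; norm_num)
  norm_num at key hk
  refine ⟨k, ?_⟩
  have : (n : ℂ) * (2 * Real.pi * I) = ((2 * k + 1 : ℤ) : ℂ) * (2 * Real.pi * I) := by
    rw [← d]; push_cast; linear_combination 2 * hk - key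
  exact_mod_cast mul_right_cancel₀ two_pi_I_ne_zero this

end HasWindingNumber

/-- The degree of a continuous map of the closed disc that is injective up to
identifications of boundary points is the same, odd, number over all interior points. -/
theorem exists_odd_windingNumber {F : ℂ → ℂ} (hF : Continuous F)
    (hinj : ∀ z ∈ closedBall (0 : ℂ) 1, ∀ w ∈ ball (0 : ℂ) 1, F z = F w → z = w) :
    ∃ d : ℤ, Odd d ∧ ∀ w ∈ ball (0 : ℂ) 1,
      HasWindingNumber (fun s => F (unitCircle s) - F w) d := by
  -- Clamping the parameter makes the homotopies below defined and nonvanishing for all real t.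
  set τ : ℝ → ℝ := fun t => max 0 (min 1 t) with hτ
  have hτc : Continuous τ := by fun_prop
  have hτ0 : ∀ t, 0 ≤ τ t := fun t => le_max_left _ _
  have hτ1 : ∀ t, τ t ≤ 1 := fun t => by simp [hτ]
  have hne : ∀ z w : ℂ, ‖z‖ ≤ 1 → ‖w‖ < 1 → z ≠ w → F z - F w ≠ 0 := fun z w hz hw h h' =>
    h (hinj z (by simpa using hz) w (by simpa using hw) (sub_eq_zero.1 h'))
  have hc := continuous_unitCircle
  obtain ⟨d, hd⟩ := HasWindingNumber.exists_of_continuous (u := fun s => F (unitCircle s) - F 0)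
    (by fun_prop) (fun s => hne _ _ (by simp) (by simp) fun h => by
      simpa [h] using norm_unitCircle s) (by simp [unitCircle_one])
  refine ⟨d, ?_, fun w hw => ?_⟩
  -- The points u/(1+t) and -tu/(1+t) always differ by the unit vector u. At t = 0 they are u and 0;
  -- at t = 1 they are antipodal, and the difference of the values of `F` becomes an odd function of
  -- u.
  · have := HasWindingNumber.of_homotopy (a := 0) (n := d)
      (H := fun x => F ((1 / (1 + τ x.2) : ℝ) * unitCircle x.1) -
        F ((τ x.2 / (1 + τ x.2) : ℝ) * (-unitCircle x.1))) ?_ ?_ (fun t => by simp [unitCircle_one])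
        (by simpa [hτ] using hd) 1
    · refine this.odd fun s => ?_
      simp only [unitCircle_add_half, hτ]
      norm_num
    · have : ∀ x : ℝ × ℝ, 1 + τ x.2 ≠ 0 := fun x => by linarith [hτ0 x.2]
      have h1 : Continuous fun x : ℝ × ℝ => 1 / (1 + τ x.2) := by
        refine Continuous.div₀ (by fun_prop) (by fun_prop) this
      have h2 : Continuous fun x : ℝ × ℝ => τ x.2 / (1 + τ x.2) := by
        refine Continuous.div₀ (by fun_prop) (by fun_prop) this
      fun_prop
    · intro x
      have h0 := hτ0 x.2
      have hp : 0 < 1 + τ x.2 := by linarith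
      refine hne _ _ ?_ ?_ fun h => ?_
      · rw [norm_mul, norm_unitCircle, mul_one, norm_real, Real.norm_eq_abs,
          abs_of_nonneg (by positivity), div_le_one hp]
        linarith
      · rw [norm_mul, norm_neg, norm_unitCircle, mul_one, norm_real, Real.norm_eq_abs,
          abs_of_nonneg (by positivity), div_lt_one hp]
        linarith
      · have h' : ((1 / (1 + τ x.2) + τ x.2 / (1 + τ x.2) : ℝ) : ℂ) * unitCircle x.1 = 0 := by
          push_cast at h ⊢
          linear_combination h
        rw [← add_div, div_self hp.ne', ofReal_one, one_mul] at h'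
        simpa [h'] using norm_unitCircle x.1
  · have := HasWindingNumber.of_homotopy (a := 0) (n := d)
      (H := fun x => F (unitCircle x.1) - F ((τ x.2 : ℂ) * w)) (by fun_prop) ?_
      (fun t => by simp [unitCircle_one]) (by simpa [hτ] using hd) 1
    · simpa [hτ] using this
    · intro x
      have hw' : ‖(τ x.2 : ℂ) * w‖ < 1 := by
        rw [norm_mul, norm_real, Real.norm_eq_abs, abs_of_nonneg (hτ0 _)]
        have : ‖w‖ < 1 := by simpa using hw
        nlinarith [hτ0 x.2, hτ1 x.2, norm_nonneg w]
      refine hne _ _ (by simp) hw' fun h => ?_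
      rw [← h, norm_unitCircle] at hw'
      exact lt_irrefl _ hw'

/-! ### Holomorphic functions of one variable -/

/-- An injective holomorphic function has nonvanishing derivative. -/
theorem OpenPartialHomeomorph.deriv_ne_zero_of_differentiableOn (f : OpenPartialHomeomorph ℂ ℂ)
    (hf : DifferentiableOn ℂ f f.source) {z : ℂ} (hz : z ∈ f.source) :
    deriv f z ≠ 0 ∧ DifferentiableAt ℂ f.symm (f z) := by
  have hs : f.source ∈ 𝓝 z := f.open_source.mem_nhds hz
  have hfz : f z ∈ f.target := f.map_source hz
  have ha : AnalyticAt ℂ f z := hf.analyticAt hs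
  have hpunct : ∀ᶠ w in 𝓝[≠] z, deriv f w ≠ 0 := by
    rcases ha.deriv.eventually_eq_zero_or_eventually_ne_zero with h | h
    · exfalso
      obtain ⟨r, hr, hball⟩ := Metric.eventually_nhds_iff_ball.1 (h.and hs)
      have hmem : z + (r / 2 : ℝ) ∈ ball z r := by
        simp only [mem_ball, dist_self_add_left, norm_real, Real.norm_eq_abs]
        rw [abs_of_pos (by linarith)]; linarith
      have hconst := (convex_ball z r).is_const_of_fderivWithin_eq_zero (𝕜 := ℂ) (f := f)
        (fun w hw => (hf.differentiableAt (f.open_source.mem_nhds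
          (hball w hw).2)).differentiableWithinAt)
        (fun w hw => by
          rw [fderivWithin_of_isOpen isOpen_ball hw]
          ext
          simpa using (hball w hw).1) (mem_ball_self hr) hmem
      have := f.injOn hz (hball _ hmem).2 hconst
      simp [hr.ne'] at this
    · exact h
  -- The zeros of f' are isolated, so the inverse is holomorphic off f z; being continuous there, it
  -- has a removable singularity, and the chain rule then forbids f' z = 0.
  have hsymm : ∀ᶠ y in 𝓝[≠] (f z), DifferentiableAt ℂ f.symm y := by
    have ht : Tendsto f.symm (𝓝[≠] (f z)) (𝓝[≠] z) := by
      rw [tendsto_nhdsWithin_iff]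
      constructor
      · have := f.symm.continuousAt hfz
        rw [ContinuousAt, f.left_inv hz] at this
        exact this.mono_left nhdsWithin_le_nhds
      · filter_upwards [self_mem_nhdsWithin,
          nhdsWithin_le_nhds (f.open_target.mem_nhds hfz)] with y hy hy' h
        rw [mem_singleton_iff] at h
        exact hy (by rw [mem_singleton_iff, ← h, f.right_inv hy'])
    filter_upwards [ht.eventually hpunct, nhdsWithin_le_nhds (f.open_target.mem_nhds hfz)]
      with y hy hy'
    have hd := (hf.differentiableAt (f.open_source.mem_nhds (f.map_target hy'))).hasDerivAt
    exact (f.hasDerivAt_symm hy' hy hd).differentiableAt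
  have hd : DifferentiableAt ℂ f.symm (f z) :=
    (analyticAt_of_differentiable_on_punctured_nhds_of_continuousAt hsymm
      (f.symm.continuousAt hfz)).differentiableAt
  refine ⟨fun h0 => ?_, hd⟩
  have hcomp : HasDerivAt (f.symm ∘ f) (deriv f.symm (f z) * deriv f z) z :=
    hd.hasDerivAt.comp z ha.differentiableAt.hasDerivAt
  have hid : HasDerivAt (f.symm ∘ f) 1 z := (hasDerivAt_id z).congr_of_eventuallyEq <| by
    filter_upwards [hs] with w hw using f.left_inv hw
  rw [h0, mul_zero] at hcomp
  exact zero_ne_one (hcomp.unique hid)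

/-- The identity theorem makes the order at `a` finite; the cofactor is the quotient away from `a`,
completed by the value of the local cofactor. -/
theorem exists_factor_zero {U : Set ℂ} {φ : ℂ → ℂ} (hφ : AnalyticOnNhd ℂ φ U)
    (hU : IsPreconnected U) (hne : ∃ x ∈ U, φ x ≠ 0) {a : ℂ} (ha : a ∈ U) :
    ∃ (m : ℕ) (ψ : ℂ → ℂ), AnalyticOnNhd ℂ ψ U ∧ ψ a ≠ 0 ∧ ∀ z ∈ U, φ z = (z - a) ^ m * ψ z := by
  have hnz : ¬ ∀ᶠ z in 𝓝 a, φ z = 0 := fun h => by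
    obtain ⟨x, hx, h0⟩ := hne
    exact h0 (hφ.eqOn_zero_of_preconnected_of_eventuallyEq_zero hU ha h hx)
  obtain ⟨m, χ, hχ, hχ0, heq⟩ := (hφ a ha).exists_eventuallyEq_pow_smul_nonzero_iff.2 hnz
  classical
  set ψ : ℂ → ℂ := fun z => if z = a then χ a else φ z / (z - a) ^ m with hψ
  have hne' : ∀ z, z ≠ a → (z - a) ^ m ≠ 0 := fun z hz => pow_ne_zero _ (sub_ne_zero.2 hz)
  refine ⟨m, ψ, fun z hz => ?_, by simpa [hψ] using hχ0, fun z hz => ?_⟩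
  · rcases eq_or_ne z a with rfl | hza
    · refine hχ.congr ?_
      filter_upwards [heq] with w hw
      by_cases h : w = z
      · simp [hψ, h]
      · simp only [hψ, h, if_false]
        rw [hw, smul_eq_mul, mul_div_cancel_left₀ _ (hne' w h)]
    · refine ((hφ z hz).div ((analyticAt_id.sub analyticAt_const).pow m) (hne' z hza)).congr ?_
      filter_upwards [isOpen_ne.mem_nhds hza] with w hw
      simp [hψ, show w ≠ a from hw]
  · rcases eq_or_ne z a with rfl | hza
    · have := heq.self_of_nhds
      simpa [hψ] using this
    · simp only [hψ, hza, if_false]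
      rw [mul_div_cancel₀ _ (hne' z hza)]

theorem exists_factor_zeros {U : Set ℂ} {φ : ℂ → ℂ} (hφ : AnalyticOnNhd ℂ φ U)
    (hU : IsPreconnected U) (hne : ∃ x ∈ U, φ x ≠ 0) (Z : Finset ℂ) (hZ : ∀ a ∈ Z, a ∈ U) :
    ∃ (m : ℂ → ℕ) (ψ : ℂ → ℂ), AnalyticOnNhd ℂ ψ U ∧ (∀ a ∈ Z, ψ a ≠ 0) ∧
      ∀ z ∈ U, φ z = (∏ a ∈ Z, (z - a) ^ m a) * ψ z := by
  classical
  induction Z using Finset.induction_on with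
  | empty => exact ⟨0, φ, hφ, by simp, by simp⟩
  | insert a Z haZ ih =>
    obtain ⟨m, ψ, hψ, hψ0, heq⟩ := ih fun b hb => hZ b (by simp [hb])
    obtain ⟨x, hx, hx0⟩ := hne
    rw [heq x hx] at hx0
    obtain ⟨k, χ, hχ, hχ0, hk⟩ := exists_factor_zero hψ hU ⟨x, hx, right_ne_zero_of_mul hx0⟩
      (hZ a (by simp))
    refine ⟨Function.update m a k, χ, hχ, fun b hb => ?_, fun z hz => ?_⟩
    · rcases Finset.mem_insert.1 hb with rfl | hb'
      · exact hχ0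
      · have := hψ0 b hb'
        rw [hk b (hZ b hb)] at this
        exact right_ne_zero_of_mul this
    · have hm : ∏ b ∈ Z, (z - b) ^ Function.update m a k b = ∏ b ∈ Z, (z - b) ^ m b :=
        Finset.prod_congr rfl fun b hb => by
          rw [Function.update_of_ne (show b ≠ a from fun h => haZ (h ▸ hb))]
      rw [heq z hz, hk z hz, Finset.prod_insert haZ, Function.update_self, hm]
      ring

theorem finite_zeros_of_isCompact {U K : Set ℂ} {φ : ℂ → ℂ} (hφ : AnalyticOnNhd ℂ φ U)
    (hU : IsPreconnected U) (hne : ∃ x ∈ U, φ x ≠ 0) (hK : IsCompact K) (hKU : K ⊆ U) :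
    {z ∈ K | φ z = 0}.Finite := by
  by_contra hinf
  obtain ⟨a, haK, ha⟩ := Set.Infinite.exists_accPt_of_subset_isCompact hinf hK (fun z hz => hz.1)
  obtain ⟨x, hx, hx0⟩ := hne
  refine hx0 (hφ.eqOn_zero_of_preconnected_of_frequently_eq_zero hU (hKU haK) ?_ hx)
  exact (accPt_iff_frequently_nhdsNE.1 ha).mono fun z hz => hz.2

/-- If `F` is a continuous map of the closed disc which is injective up to identifications of
boundary points, and `φ` is holomorphic, then the winding number of `φ ∘ F` along the boundary is
at least the number of zeros of `φ ∘ F`. -/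
theorem card_zeros_le_abs_windingNumber {F : ℂ → ℂ} (hF : Continuous F)
    (hinj : ∀ z ∈ closedBall (0 : ℂ) 1, ∀ w ∈ ball (0 : ℂ) 1, F z = F w → z = w)
    {U : Set ℂ} {φ : ℂ → ℂ} (hφ : AnalyticOnNhd ℂ φ U) (hU : IsPreconnected U)
    (hFU : ∀ z, F z ∈ U) (hretr : ∀ z, F z ∈ F '' closedBall (0 : ℂ) 1)
    (hbd : ∀ s, φ (F (unitCircle s)) ≠ 0)
    {T : Finset ℂ} (hT : ∀ w ∈ T, w ∈ closedBall (0 : ℂ) 1 ∧ φ (F w) = 0) {n : ℤ}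
    (hn : HasWindingNumber (fun s => φ (F (unitCircle s))) n) : (T.card : ℤ) ≤ |n| := by
  classical
  obtain ⟨d, hdodd, hd⟩ := exists_odd_windingNumber hF hinj
  have hne : ∃ x ∈ U, φ x ≠ 0 := ⟨_, hFU _, hbd 0⟩
  have hfin := finite_zeros_of_isCompact hφ hU hne
    ((isCompact_closedBall (0 : ℂ) 1).image hF) (by rintro _ ⟨z, -, rfl⟩; exact hFU z)
  have hint : ∀ w ∈ closedBall (0 : ℂ) 1, φ (F w) = 0 → w ∈ ball (0 : ℂ) 1 := fun w hw h0 => by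
    rw [mem_ball_zero_iff]
    refine lt_of_le_of_ne (by simpa using hw) fun h1 => ?_
    refine hbd (arg w / (2 * Real.pi)) ?_
    have : unitCircle (arg w / (2 * Real.pi)) = w := by
      rw [unitCircle, mul_div_cancel₀ _ Real.two_pi_pos.ne']
      simpa [h1] using norm_mul_exp_arg_mul_I w
    rw [this, h0]
  obtain ⟨m, ψ, hψ, hψ0, hfac⟩ := exists_factor_zeros hφ hU hne hfin.toFinset
    (fun a ha => by obtain ⟨⟨z, -, rfl⟩, -⟩ := hfin.mem_toFinset.1 ha; exact hFU z)
  have hψF : ∀ z, ψ (F z) ≠ 0 := fun z h => by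
    by_cases h0 : φ (F z) = 0
    · exact hψ0 (F z) (hfin.mem_toFinset.2 ⟨hretr z, h0⟩) h
    · rw [hfac _ (hFU z), h, mul_zero] at h0
      exact h0 rfl
  -- Having no zeros on the image of `F`, the cofactor gives a nonvanishing function on the whole
  -- plane; only the linear factors wind.
  have hψw : HasWindingNumber (fun s => ψ (F (unitCircle s))) 0 :=
    HasWindingNumber.comp_unitCircle (u := fun z => ψ (F z))
      (continuous_iff_continuousAt.2 fun z =>
        ((hψ _ (hFU z)).continuousAt.comp hF.continuousAt)) hψF
  have hprod : HasWindingNumber (fun s => ∏ a ∈ hfin.toFinset, (F (unitCircle s) - a) ^ m a)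
      (∑ a ∈ hfin.toFinset, m a * d) := by
    refine HasWindingNumber.prod _ fun a ha => HasWindingNumber.pow ?_ _
    obtain ⟨⟨z, hz, rfl⟩, h0⟩ := hfin.mem_toFinset.1 ha
    exact hd z (hint z hz h0)
  have htot := hprod.mul hψw
  simp only [← hfac _ (hFU _)] at htot
  have hnd := hn.unique htot
  rw [add_zero, ← Finset.sum_mul] at hnd
  have hpos : ∀ a ∈ hfin.toFinset, 1 ≤ m a := fun a ha => by
    rw [Nat.one_le_iff_ne_zero]
    intro hm
    have haU : a ∈ U := by obtain ⟨⟨z, -, rfl⟩, -⟩ := hfin.mem_toFinset.1 ha; exact hFU z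
    have h0 : φ a = 0 := (hfin.mem_toFinset.1 ha).2
    rw [hfac a haU] at h0
    refine mul_ne_zero (Finset.prod_ne_zero_iff.2 fun b hb => ?_) (hψ0 a ha) h0
    rcases eq_or_ne a b with rfl | hab
    · simp [hm]
    · exact pow_ne_zero _ (sub_ne_zero.2 hab)
  have hcard : T.card ≤ hfin.toFinset.card := by
    refine Finset.card_le_card_of_injOn F (fun w hw => ?_) fun z hz w hw h => ?_
    · exact hfin.mem_toFinset.2 ⟨⟨w, (hT w hw).1, rfl⟩, (hT w hw).2⟩
    · exact hinj z (hT z hz).1 w (hint w (hT w hw).1 (hT w hw).2) h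
  have hsum : (hfin.toFinset.card : ℤ) ≤ ∑ a ∈ hfin.toFinset, (m a : ℤ) := by
    have := Finset.card_nsmul_le_sum hfin.toFinset m 1 hpos
    simp only [smul_eq_mul, mul_one] at this
    exact_mod_cast this
  -- The orientation of `F` is unknown, so only the absolute value of the degree is usable; oddness
  -- excludes 0.
  have hd1 : 1 ≤ |d| := Int.one_le_abs fun h => by simp [h] at hdodd
  rw [hnd, abs_mul]
  have h0 : (0 : ℤ) ≤ ∑ a ∈ hfin.toFinset, (m a : ℤ) := Finset.sum_nonneg fun a _ => by positivity
  rw [abs_of_nonneg h0]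
  have : (T.card : ℤ) ≤ hfin.toFinset.card := by exact_mod_cast hcard
  nlinarith

/-! ### Automorphisms of the upper half-plane -/

/-- The Cayley transform that maps the upper half-plane to the unit disc and `a` to `0`. -/
noncomputable def cayley (a z : ℂ) : ℂ := (z - a) / (z - (starRingEnd ℂ) a)

/-- The inverse of the Cayley transform. -/
noncomputable def cayleyInv (a v : ℂ) : ℂ := (a - (starRingEnd ℂ) a * v) / (1 - v)

section Cayley

variable {a z v : ℂ}

theorem sub_conj_ne_zero_of_im_pos (ha : 0 < a.im) (hz : 0 < z.im) :
    z - (starRingEnd ℂ) a ≠ 0 := fun h => by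
  have := congrArg im h
  simp at this
  linarith

theorem one_sub_ne_zero_of_norm_lt_one (hv : ‖v‖ < 1) : 1 - v ≠ 0 := fun h => by
  rw [← sub_eq_zero.1 h] at hv
  simp at hv

theorem norm_cayley_lt_one (ha : 0 < a.im) (hz : 0 < z.im) : ‖cayley a z‖ < 1 := by
  rw [cayley, norm_div, div_lt_one (norm_pos_iff.2 (sub_conj_ne_zero_of_im_pos ha hz)),
    ← sq_lt_sq₀ (norm_nonneg _) (norm_nonneg _), ← normSq_eq_norm_sq, ← normSq_eq_norm_sq,
    normSq_apply, normSq_apply]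
  simp
  nlinarith

theorem cayleyInv_im_pos (ha : 0 < a.im) (hv : ‖v‖ < 1) : 0 < (cayleyInv a v).im := by
  have h1 : 0 < normSq (1 - v) := normSq_pos.2 (one_sub_ne_zero_of_norm_lt_one hv)
  have h2 : normSq v < 1 := by
    rw [normSq_eq_norm_sq]; nlinarith [norm_nonneg v]
  rw [normSq_apply] at h2
  have : (cayleyInv a v).im = a.im * (1 - (v.re * v.re + v.im * v.im)) / normSq (1 - v) := by
    rw [cayleyInv, div_im]
    simp
    field_simp
    ring
  rw [this]
  have : 0 < 1 - (v.re * v.re + v.im * v.im) := by linarith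
  positivity

theorem cayley_cayleyInv (ha : 0 < a.im) (hv : ‖v‖ < 1) : cayley a (cayleyInv a v) = v := by
  have h1 := one_sub_ne_zero_of_norm_lt_one hv
  have h2 := sub_conj_ne_zero_of_im_pos ha (cayleyInv_im_pos ha hv)
  rw [cayley, div_eq_iff h2, cayleyInv]
  field_simp
  ring

theorem cayleyInv_cayley (ha : 0 < a.im) (hz : 0 < z.im) : cayleyInv a (cayley a z) = z := by
  have h1 := one_sub_ne_zero_of_norm_lt_one (norm_cayley_lt_one ha hz)
  have h2 := sub_conj_ne_zero_of_im_pos ha hz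
  rw [cayleyInv, div_eq_iff h1, cayley]
  field_simp
  ring

theorem differentiableAt_cayley (ha : 0 < a.im) (hz : 0 < z.im) :
    DifferentiableAt ℂ (cayley a) z := by
  unfold cayley
  exact DifferentiableAt.fun_div (by fun_prop) (by fun_prop) (sub_conj_ne_zero_of_im_pos ha hz)

theorem differentiableAt_cayleyInv (hv : ‖v‖ < 1) : DifferentiableAt ℂ (cayleyInv a) v := by
  unfold cayleyInv
  exact DifferentiableAt.fun_div (by fun_prop) (by fun_prop) (one_sub_ne_zero_of_norm_lt_one hv)

end Cayley

section Automorphism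

variable {γ δ : ℂ → ℂ}

/-- Schwarz's lemma: the disc maps induced by γ and δ fix 0 and do not increase norms. As the second
undoes the first, equality holds at the test point 1/2, so the first is linear. -/
theorem exists_cayley_conj_eq_mul (hγ : DifferentiableOn ℂ γ {z | 0 < z.im})
    (hδ : DifferentiableOn ℂ δ {z | 0 < z.im}) (hγU : ∀ z : ℂ, 0 < z.im → 0 < (γ z).im)
    (hδU : ∀ z : ℂ, 0 < z.im → 0 < (δ z).im) (hδγ : ∀ z : ℂ, 0 < z.im → δ (γ z) = z) {a : ℂ}
    (ha : 0 < a.im) :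
    ∃ C : ℂ, ∀ z : ℂ, 0 < z.im → cayley (γ a) (γ z) = cayley a z * C := by
  have hb := hγU a ha
  have hopen : IsOpen {z : ℂ | 0 < z.im} := isOpen_lt continuous_const continuous_im
  have key : ∀ (η : ℂ → ℂ) (a b : ℂ), DifferentiableOn ℂ η {z | 0 < z.im} →
      (∀ z : ℂ, 0 < z.im → 0 < (η z).im) → 0 < a.im → 0 < b.im →
      DifferentiableOn ℂ (fun v => cayley b (η (cayleyInv a v))) (ball 0 1) ∧
      MapsTo (fun v => cayley b (η (cayleyInv a v))) (ball 0 1) (ball 0 1) := by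
    intro η a b hη hηU ha hb
    refine ⟨fun v hv => ?_, fun v hv => ?_⟩
    · rw [mem_ball_zero_iff] at hv
      have hv' := cayleyInv_im_pos ha hv
      exact ((differentiableAt_cayley hb (hηU _ hv')).comp v
        ((hη.differentiableAt (hopen.mem_nhds hv')).comp v
          (differentiableAt_cayleyInv hv))).differentiableWithinAt
    · rw [mem_ball_zero_iff] at hv ⊢
      exact norm_cayley_lt_one hb (hηU _ (cayleyInv_im_pos ha hv))
  obtain ⟨hσd, hσm⟩ := key γ a (γ a) hγ hγU ha hb
  obtain ⟨hσd', hσm'⟩ := key δ (γ a) a hδ hδU hb ha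
  set σ : ℂ → ℂ := fun v => cayley (γ a) (γ (cayleyInv a v)) with hσ
  set σ' : ℂ → ℂ := fun v => cayley a (δ (cayleyInv (γ a) v)) with hσ'
  have hσ0 : σ 0 = 0 := by simp [hσ, cayley, cayleyInv]
  have hσ'0 : σ' 0 = 0 := by simp [hσ', cayley, cayleyInv, hδγ a ha]
  have hinv : ∀ v : ℂ, ‖v‖ < 1 → σ' (σ v) = v := fun v hv => by
    have h1 := cayleyInv_im_pos ha hv
    simp only [hσ, hσ']
    rw [cayleyInv_cayley hb (hγU _ h1), hδγ _ h1, cayley_cayleyInv ha hv]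
  have hhalf : ‖(1 / 2 : ℂ)‖ < 1 := by norm_num
  have hle1 := norm_le_norm_of_mapsTo_ball hσd (fun v hv => ball_subset_closedBall (hσm hv)) hσ0
    hhalf
  have hle2 := norm_le_norm_of_mapsTo_ball hσd' (fun v hv => ball_subset_closedBall (hσm' hv)) hσ'0
    (z := σ (1 / 2)) (by simpa using hσm (show (1 / 2 : ℂ) ∈ ball 0 1 by simpa using hhalf))
  rw [hinv _ hhalf] at hle2
  have hds : ‖dslope σ 0 (1 / 2)‖ = 1 / 1 := by
    rw [dslope_of_ne _ (by norm_num), slope_def_field, hσ0, sub_zero, sub_zero, norm_div,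
      le_antisymm hle1 hle2]
    norm_num
  have haff := affine_of_mapsTo_ball_of_norm_dslope_eq_div (z₀ := 1 / 2) hσd
    (by rw [hσ0]; exact fun v hv => ball_subset_closedBall (hσm hv)) (by simpa using hhalf) hds
  refine ⟨dslope σ 0 (1 / 2), fun z hz => ?_⟩
  have hv := norm_cayley_lt_one ha hz
  have := haff (show cayley a z ∈ ball 0 1 by simpa using hv)
  simp only [hσ0, zero_add, sub_zero, smul_eq_mul] at this
  rw [← this]
  simp only [hσ]
  rw [cayleyInv_cayley ha hz]

/-- The derivative of a holomorphic automorphism of the upper half-plane. -/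
theorem exists_hasDerivAt_automorphism (hγ : DifferentiableOn ℂ γ {z | 0 < z.im})
    (hδ : DifferentiableOn ℂ δ {z | 0 < z.im}) (hγU : ∀ z : ℂ, 0 < z.im → 0 < (γ z).im)
    (hδU : ∀ z : ℂ, 0 < z.im → 0 < (δ z).im) (hδγ : ∀ z : ℂ, 0 < z.im → δ (γ z) = z) :
    ∃ κ α β : ℂ, κ ≠ 0 ∧ ∀ z : ℂ, 0 < z.im →
      α * z + β ≠ 0 ∧ HasDerivAt γ (κ / (α * z + β) ^ 2) z := by
  have hopen : IsOpen {z : ℂ | 0 < z.im} := isOpen_lt continuous_const continuous_im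
  have ha : 0 < I.im := by simp
  obtain ⟨C, hC⟩ := exists_cayley_conj_eq_mul hγ hδ hγU hδU hδγ ha
  have hb := hγU I ha
  set b := γ I
  set b' := (starRingEnd ℂ) b
  have hI : (starRingEnd ℂ) I = -I := conj_I
  have hL : ∀ z : ℂ, 0 < z.im → (1 - C) * z + (C * I + I) ≠ 0 := fun z hz => by
    have h1 := one_sub_ne_zero_of_norm_lt_one (norm_cayley_lt_one hb (hγU z hz))
    have h2 := sub_conj_ne_zero_of_im_pos ha hz
    rw [hC z hz, cayley] at h1
    have h3 := mul_ne_zero h2 h1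
    rw [mul_sub, mul_one, ← mul_assoc, mul_div_cancel₀ _ h2, hI] at h3
    convert h3 using 1
    ring
  -- Solving the Cayley relation for γ exhibits it as a Möbius map; κ below is its determinant.
  have hform : ∀ z : ℂ, 0 < z.im →
      γ z = ((b - b' * C) * z + (b' * C * I + b * I)) / ((1 - C) * z + (C * I + I)) := by
    intro z hz
    have h2 := sub_conj_ne_zero_of_im_pos ha hz
    have h3 := cayleyInv_cayley hb (hγU z hz)
    have h1 := one_sub_ne_zero_of_norm_lt_one (norm_cayley_lt_one hb (hγU z hz))
    rw [cayleyInv, div_eq_iff h1, hC z hz, cayley] at h3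
    rw [eq_div_iff (hL z hz)]
    rw [hI] at h3 h2
    field_simp at h3
    simp only [b'] at h3 ⊢
    linear_combination -h3
  set κ : ℂ := (b - b' * C) * (C * I + I) - (1 - C) * (b' * C * I + b * I) with hκ
  have hder : ∀ z : ℂ, 0 < z.im → HasDerivAt γ (κ / ((1 - C) * z + (C * I + I)) ^ 2) z := by
    intro z hz
    have h1 : HasDerivAt (fun z : ℂ => (b - b' * C) * z + (b' * C * I + b * I)) (b - b' * C) z := by
      simpa using ((hasDerivAt_id z).const_mul (b - b' * C)).add_const (b' * C * I + b * I)
    have h2 : HasDerivAt (fun z : ℂ => (1 - C) * z + (C * I + I)) (1 - C) z := by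
      simpa using ((hasDerivAt_id z).const_mul (1 - C)).add_const (C * I + I)
    have h3 := h1.div h2 (hL z hz)
    refine HasDerivAt.congr_of_eventuallyEq ?_
      (eventually_of_mem (hopen.mem_nhds hz) fun w hw => hform w hw)
    have h4 : κ = (b - b' * C) * ((1 - C) * z + (C * I + I)) -
        ((b - b' * C) * z + (b' * C * I + b * I)) * (1 - C) := by rw [hκ]; ring
    rw [h4]
    exact h3
  refine ⟨κ, 1 - C, C * I + I, fun h0 => ?_, fun z hz => ⟨hL z hz, hder z hz⟩⟩
  have h1 : HasDerivAt (δ ∘ γ) (deriv δ (γ I) * (κ / ((1 - C) * I + (C * I + I)) ^ 2)) I :=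
    (hδ.differentiableAt (hopen.mem_nhds hb)).hasDerivAt.comp I (hder I ha)
  have h2 : HasDerivAt (δ ∘ γ) 1 I := (hasDerivAt_id I).congr_of_eventuallyEq
    (eventually_of_mem (hopen.mem_nhds ha) fun w hw => hδγ w hw)
  have := h1.unique h2
  simp [h0] at this

/-- The square of the derivative of a holomorphic automorphism of the upper half-plane has a
logarithm whose imaginary part varies by less than `4π`. -/
theorem exists_log_deriv_sq_automorphism (hγ : DifferentiableOn ℂ γ {z | 0 < z.im})
    (hδ : DifferentiableOn ℂ δ {z | 0 < z.im}) (hγU : ∀ z : ℂ, 0 < z.im → 0 < (γ z).im)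
    (hδU : ∀ z : ℂ, 0 < z.im → 0 < (δ z).im) (hδγ : ∀ z : ℂ, 0 < z.im → δ (γ z) = z) :
    ∃ m : ℂ → ℂ, ContinuousOn m {z | 0 < z.im} ∧
      (∀ z : ℂ, 0 < z.im → exp (m z) = deriv γ z ^ 2) ∧
      ∀ z w : ℂ, 0 < z.im → 0 < w.im → |(m z).im - (m w).im| < 4 * Real.pi := by
  obtain ⟨κ, α, β, hκ, h⟩ := exists_hasDerivAt_automorphism hγ hδ hγU hδU hδγ
  rcases eq_or_ne α 0 with rfl | hα
  · refine ⟨fun _ => log ((κ / β ^ 2) ^ 2), continuousOn_const, fun z hz => ?_,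
      fun z w _ _ => by simpa using Real.pi_pos⟩
    obtain ⟨h1, h2⟩ := h z hz
    simp only [zero_mul, zero_add] at h1 h2
    rw [h2.deriv, exp_log (pow_ne_zero _ (div_ne_zero hκ (pow_ne_zero _ h1)))]
  -- The pole -β/α cannot lie in ℍ. Translation by β/α hence keeps ℍ inside itself, where arg takes
  -- values in (0, π); the fourth power in γ'² gives the variation 4π.
  · have hw : ∀ z : ℂ, 0 < z.im → 0 < (z + β / α).im := fun z hz => by
      by_contra! hle
      have h0 : 0 < (-(β / α)).im := by
        rw [add_im] at hle
        rw [neg_im]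
        linarith
      refine (h _ h0).1 ?_
      field_simp
      ring
    refine ⟨fun z => log ((κ / α ^ 2) ^ 2) - 4 * log (z + β / α), fun z hz => ?_,
      fun z hz => ?_, fun z w hz hw' => ?_⟩
    · refine ContinuousAt.continuousWithinAt ?_
      have : z + β / α ∈ slitPlane := Or.inr (hw z hz).ne'
      have := continuousAt_clog this
      fun_prop (disch := assumption)
    · have hne : z + β / α ≠ 0 := fun h0 => by simpa [h0] using hw z hz
      rw [exp_sub, exp_log (pow_ne_zero _ (div_ne_zero hκ (pow_ne_zero _ hα))),
        show (4 : ℂ) = ((4 : ℕ) : ℂ) by norm_num, exp_nat_mul, exp_log hne, (h z hz).2.deriv]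
      have : α * z + β = α * (z + β / α) := by field_simp
      rw [this]
      field_simp
    · have h1 : ∀ z : ℂ, 0 < z.im → 0 < arg z ∧ arg z < Real.pi := fun z hz => by
        refine ⟨lt_of_le_of_ne (arg_nonneg_iff.2 hz.le) fun h0 => ?_,
          lt_of_le_of_ne (arg_le_pi z) fun h0 => ?_⟩
        · exact hz.ne' (arg_eq_zero_iff.1 h0.symm).2
        · exact hz.ne' (arg_eq_pi_iff.1 h0).2
      have hz1 := h1 _ (hw z hz)
      have hw1 := h1 _ (hw w hw')
      have hre : ∀ x : ℂ, (4 * log x).im = 4 * arg x := fun x => by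
        simp [mul_im, log_im]
      simp only [sub_im, hre]
      rw [abs_lt]
      constructor <;> linarith [hz1.1, hz1.2, hw1.1, hw1.2]

end Automorphism

/-! ### Quadratic differentials on the universal covering -/

theorem isOpen_im_pos : IsOpen {z : ℂ | 0 < z.im} := isOpen_lt continuous_const continuous_im

theorem isPreconnected_im_pos : IsPreconnected {z : ℂ | 0 < z.im} :=
  (convex_halfSpace_im_gt 0).isPreconnected

theorem coe_ofComplex {w : ℂ} (hw : 0 < w.im) : (UpperHalfPlane.ofComplex w : ℂ) = w := by
  rw [UpperHalfPlane.ofComplex_apply_of_im_pos hw]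

theorem ofComplex_source : UpperHalfPlane.ofComplex.source = {z : ℂ | 0 < z.im} := by
  ext z
  simp only [UpperHalfPlane.ofComplex, OpenPartialHomeomorph.symm_source,
    IsOpenEmbedding.toOpenPartialHomeomorph_target, mem_range, mem_ofPred_eq]
  exact ⟨fun ⟨y, hy⟩ => hy ▸ y.im_pos, fun h => ⟨⟨z, h⟩, rfl⟩⟩

/-- The image is open, and closed because a trivialization around x carries any point over a nearby
y to a point over x. -/
theorem IsCoveringMap.surjective_of_connectedSpace {E X : Type*} [TopologicalSpace E]
    [TopologicalSpace X] [Nonempty E] [PreconnectedSpace X] {p : E → X} (hp : IsCoveringMap p) :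
    Function.Surjective p := by
  rw [← range_eq_univ]
  refine IsClopen.eq_univ ⟨⟨?_⟩, hp.isLocalHomeomorph.isOpenMap.isOpen_range⟩ (range_nonempty p)
  rw [isOpen_iff_forall_mem_open]
  intro x hx
  obtain ⟨-, U, hxU, hU, -, H, hH⟩ := hp x
  refine ⟨U, ?_, hU, hxU⟩
  rintro _ hy ⟨e, rfl⟩
  exact hx ⟨_, (H ⟨e, hy⟩).2.2⟩

section Covering

variable {S : Type*} [TopologicalSpace S] [ChartedSpace ℂ S]

/-- The expression of a map `p : ℍ → S` in the chart `e`. -/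
noncomputable def localExpr (p : ℍ → S) (e : OpenPartialHomeomorph S ℂ) (w : ℂ) : ℂ :=
  e (p (UpperHalfPlane.ofComplex w))

/-- The pullback to `ℍ` of a quadratic differential under a map `p : ℍ → S`. -/
noncomputable def pullbackDifferential (p : ℍ → S) (φ : BersSpace S) (w : ℂ) : ℂ :=
  φ.coeff ⟨chartAt ℂ (p (UpperHalfPlane.ofComplex w)), chart_mem_atlas ℂ _⟩
      (localExpr p (chartAt ℂ (p (UpperHalfPlane.ofComplex w))) w) *
    deriv (localExpr p (chartAt ℂ (p (UpperHalfPlane.ofComplex w)))) w ^ 2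

variable {p : ℍ → S}

theorem IsHolomorphicCovering.continuousAt_comp_ofComplex (hp : IsHolomorphicCovering p)
    {w : ℂ} (hw : 0 < w.im) :
    ContinuousAt (fun w : ℂ => p (UpperHalfPlane.ofComplex w)) w :=
  hp.1.continuous.continuousAt.comp (UpperHalfPlane.mdifferentiableAt_ofComplex hw).continuousAt

variable [IsManifold 𝓘(ℂ) 1 S]

theorem IsHolomorphicCovering.differentiableAt_localExpr (hp : IsHolomorphicCovering p)
    {e : OpenPartialHomeomorph S ℂ}
    (he : e ∈ atlas ℂ S) {w : ℂ} (hw : 0 < w.im)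
    (hwe : p (UpperHalfPlane.ofComplex w) ∈ e.source) : DifferentiableAt ℂ (localExpr p e) w := by
  rw [← mdifferentiableAt_iff_differentiableAt]
  exact (mdifferentiableAt_atlas (I := 𝓘(ℂ)) he hwe).comp w
    ((hp.2 _).comp w (UpperHalfPlane.mdifferentiableAt_ofComplex hw))

/-- In charts `p` is locally an injective holomorphic function, so it has nonzero derivative and a
holomorphic local inverse. -/
theorem IsHolomorphicCovering.exists_openPartialHomeomorph (hp : IsHolomorphicCovering p)
    {e : OpenPartialHomeomorph S ℂ}
    (he : e ∈ atlas ℂ S) {w : ℂ} (hw : 0 < w.im)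
    (hwe : p (UpperHalfPlane.ofComplex w) ∈ e.source) :
    ∃ f : OpenPartialHomeomorph ℂ ℂ, w ∈ f.source ∧ f = localExpr p e ∧
      DifferentiableOn ℂ f f.source := by
  obtain ⟨P, hP, hPp⟩ := hp.1.isLocalHomeomorph (UpperHalfPlane.ofComplex w)
  have hfun : ((UpperHalfPlane.ofComplex.trans P).trans e : ℂ → ℂ) = localExpr p e := by
    ext z
    simp [localExpr, hPp]
  have hsrc : ∀ z, z ∈ ((UpperHalfPlane.ofComplex.trans P).trans e).source →
      0 < z.im ∧ p (UpperHalfPlane.ofComplex z) ∈ e.source := fun z hz => by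
    simp only [OpenPartialHomeomorph.trans_source, mem_inter_iff, mem_preimage,
      OpenPartialHomeomorph.coe_trans, Function.comp_apply, ← hPp, ofComplex_source,
      mem_ofPred_eq] at hz
    exact ⟨hz.1.1, hz.2⟩
  refine ⟨_, ?_, hfun, fun z hz => ?_⟩
  · simp only [OpenPartialHomeomorph.trans_source, mem_inter_iff, mem_preimage,
      OpenPartialHomeomorph.coe_trans, Function.comp_apply, ← hPp, ofComplex_source,
      mem_ofPred_eq]
    exact ⟨⟨hw, hP⟩, hwe⟩
  · rw [hfun]
    exact (hp.differentiableAt_localExpr he (hsrc z hz).1 (hsrc z hz).2).differentiableWithinAt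

/-- The transformation law of φ cancels the chain rule factor, so one fixed chart can be used near a
point although the definition changes charts from point to point. -/
theorem IsHolomorphicCovering.pullbackDifferential_eq (hp : IsHolomorphicCovering p)
    (φ : BersSpace S)
    {e : OpenPartialHomeomorph S ℂ} (he : e ∈ atlas ℂ S) {w : ℂ} (hw : 0 < w.im)
    (hwe : p (UpperHalfPlane.ofComplex w) ∈ e.source) :
    pullbackDifferential p φ w =
      φ.coeff ⟨e, he⟩ (localExpr p e w) * deriv (localExpr p e) w ^ 2 := by
  unfold pullbackDifferential
  set x := p (UpperHalfPlane.ofComplex w) with hx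
  set e₁ := chartAt ℂ x with he₁
  have hx₁ : x ∈ e₁.source := mem_chart_source ℂ x
  have hz₁ : localExpr p e₁ w = e₁ x := rfl
  have htr := φ.2.2.2 ⟨e₁, chart_mem_atlas ℂ x⟩ ⟨e, he⟩ (e₁ x) (by
    simp only [OpenPartialHomeomorph.trans_source, OpenPartialHomeomorph.symm_source,
      mem_inter_iff, mem_preimage, e₁.left_inv hx₁]
    exact ⟨e₁.map_source hx₁, hwe⟩)
  have hdh : DifferentiableAt ℂ (fun v : ℂ => e (e₁.symm v)) (localExpr p e₁ w) := by
    rw [← mdifferentiableAt_iff_differentiableAt, hz₁]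
    refine MDifferentiableAt.comp (I' := 𝓘(ℂ)) (e₁ x) (g := e) ?_
      (mdifferentiableAt_atlas_symm (I := 𝓘(ℂ)) (chart_mem_atlas ℂ x) (e₁.map_source hx₁))
    exact mdifferentiableAt_atlas he (by rwa [e₁.left_inv hx₁])
  have hd₁ := hp.differentiableAt_localExpr (chart_mem_atlas ℂ x) hw hx₁
  have hcomp := hdh.hasDerivAt.comp w hd₁.hasDerivAt
  have hev : localExpr p e =ᶠ[𝓝 w] (fun v : ℂ => e (e₁.symm v)) ∘ localExpr p e₁ := by
    filter_upwards [(hp.continuousAt_comp_ofComplex hw).eventually_mem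
      (e₁.open_source.mem_nhds hx₁)] with v hv
    simp only [localExpr, Function.comp_apply]
    rw [e₁.left_inv hv]
  have hder := (hcomp.congr_of_eventuallyEq hev).deriv
  rw [hder]
  simp only [e₁.left_inv hx₁] at htr
  change φ.1 _ (e₁ x) * _ = φ.1 _ (e x) * _
  rw [htr, hz₁]
  ring

theorem IsHolomorphicCovering.analyticOnNhd_pullbackDifferential (hp : IsHolomorphicCovering p)
    (φ : BersSpace S) :
    AnalyticOnNhd ℂ (pullbackDifferential p φ) {z | 0 < z.im} := by
  refine DifferentiableOn.analyticOnNhd (fun w hw => ?_) isOpen_im_pos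
  set x := p (UpperHalfPlane.ofComplex w) with hx
  have he := chart_mem_atlas ℂ x
  have hxe : x ∈ (chartAt ℂ x).source := mem_chart_source ℂ x
  set e := chartAt ℂ x
  have hnear : ∀ᶠ v in 𝓝 w, 0 < v.im ∧ p (UpperHalfPlane.ofComplex v) ∈ e.source :=
    (show ∀ᶠ v : ℂ in 𝓝 w, 0 < v.im from isOpen_im_pos.mem_nhds hw).and
      ((hp.continuousAt_comp_ofComplex hw).eventually_mem (e.open_source.mem_nhds hxe))
  have han : AnalyticAt ℂ (localExpr p e) w := by
    rw [analyticAt_iff_eventually_differentiableAt]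
    exact hnear.mono fun v hv => hp.differentiableAt_localExpr he hv.1 hv.2
  have hφ : DifferentiableAt ℂ (φ.coeff ⟨e, he⟩) (localExpr p e w) :=
    (φ.2.1 ⟨e, he⟩).differentiableAt (e.open_target.mem_nhds (e.map_source hxe))
  have hd : DifferentiableAt ℂ (fun v => φ.coeff ⟨e, he⟩ (localExpr p e v) *
      deriv (localExpr p e) v ^ 2) w :=
    (hφ.comp w han.differentiableAt).mul (han.deriv.differentiableAt.pow 2)
  refine (hd.congr_of_eventuallyEq ?_).differentiableWithinAt
  exact hnear.mono fun v hv => hp.pullbackDifferential_eq φ he hv.1 hv.2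

theorem IsHolomorphicCovering.exists_pullbackDifferential_ne_zero (hp : IsHolomorphicCovering p)
    [PreconnectedSpace S]
    {φ : BersSpace S} (hφ : φ ≠ 0) : ∃ w ∈ {z : ℂ | 0 < z.im}, pullbackDifferential p φ w ≠ 0 := by
  have hex : ∃ (e : atlas ℂ S) (z : ℂ), φ.coeff e z ≠ 0 := by
    by_contra! h
    exact hφ (Subtype.ext (funext fun e => funext fun z => h e z))
  obtain ⟨⟨e, he⟩, z, hz⟩ := hex
  have hzt : z ∈ e.target := by
    by_contra h
    exact hz (φ.2.2.1 ⟨e, he⟩ z h)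
  obtain ⟨τ, hτ⟩ := hp.1.surjective_of_connectedSpace (e.symm z)
  have hτe : p (UpperHalfPlane.ofComplex τ) ∈ e.source := by
    rw [UpperHalfPlane.ofComplex_apply, hτ]
    exact e.map_target hzt
  obtain ⟨f, hf, hfe, hfd⟩ := hp.exists_openPartialHomeomorph he τ.im_pos hτe
  refine ⟨τ, τ.im_pos, ?_⟩
  rw [hp.pullbackDifferential_eq φ he τ.im_pos hτe]
  have hval : localExpr p e τ = z := by
    rw [localExpr, UpperHalfPlane.ofComplex_apply, hτ, e.right_inv hzt]
  rw [hval]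
  refine mul_ne_zero hz (pow_ne_zero 2 ?_)
  rw [← hfe]
  exact (f.deriv_ne_zero_of_differentiableOn hfd hf).1

/-- Near w, γ is `p` followed by its local inverse at γ w, hence holomorphic; the formula is the
derivative of p ∘ γ = p. -/
theorem IsHolomorphicCovering.hasDerivAt_deck (hp : IsHolomorphicCovering p)
    {γ : C(ℍ, ℍ)} (hγ : ∀ τ, p (γ τ) = p τ)
    {e : OpenPartialHomeomorph S ℂ} (he : e ∈ atlas ℂ S) {w : ℂ} (hw : 0 < w.im)
    (hwe : p (UpperHalfPlane.ofComplex w) ∈ e.source) :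
    DifferentiableAt ℂ (fun v : ℂ => (γ (UpperHalfPlane.ofComplex v) : ℂ)) w ∧
    deriv (localExpr p e) w =
      deriv (localExpr p e) (γ (UpperHalfPlane.ofComplex w)) *
        deriv (fun v : ℂ => (γ (UpperHalfPlane.ofComplex v) : ℂ)) w := by
  set γc : ℂ → ℂ := fun v => (γ (UpperHalfPlane.ofComplex v) : ℂ) with hγc
  have hγcont : ContinuousAt γc w := UpperHalfPlane.continuous_coe.continuousAt.comp
    (γ.continuous.continuousAt.comp (UpperHalfPlane.mdifferentiableAt_ofComplex hw).continuousAt)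
  have hγe : p (UpperHalfPlane.ofComplex (γc w)) ∈ e.source := by
    simp only [hγc, UpperHalfPlane.ofComplex_apply, hγ]
    exact hwe
  have hlocal : ∀ v, localExpr p e (γc v) = localExpr p e v := fun v => by
    simp only [localExpr, hγc, UpperHalfPlane.ofComplex_apply, hγ]
  have hγim : 0 < (γc w).im := (γ _).im_pos
  obtain ⟨f, hf, hfe, hfd⟩ := hp.exists_openPartialHomeomorph he hγim hγe
  have hev : γc =ᶠ[𝓝 w] f.symm ∘ localExpr p e := by
    filter_upwards [hγcont.eventually_mem (f.open_source.mem_nhds hf)] with v hv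
    rw [Function.comp_apply, ← hlocal, ← hfe, f.left_inv hv]
  have hd : DifferentiableAt ℂ γc w := by
    refine DifferentiableAt.congr_of_eventuallyEq ?_ hev
    refine DifferentiableAt.comp w ?_ (hp.differentiableAt_localExpr he hw hwe)
    rw [← hlocal, ← hfe]
    exact (f.deriv_ne_zero_of_differentiableOn hfd hf).2
  refine ⟨hd, ?_⟩
  have := (hp.differentiableAt_localExpr he hγim hγe).hasDerivAt.comp w hd.hasDerivAt
  rw [← this.deriv]
  congr 1
  ext v
  exact (hlocal v).symm

theorem IsHolomorphicCovering.differentiableOn_deck (hp : IsHolomorphicCovering p)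
    {γ : C(ℍ, ℍ)} (hγ : ∀ τ, p (γ τ) = p τ) :
    DifferentiableOn ℂ (fun v : ℂ => (γ (UpperHalfPlane.ofComplex v) : ℂ)) {z | 0 < z.im} :=
  fun _ hw => (hp.hasDerivAt_deck hγ (chart_mem_atlas ℂ _) hw
    (mem_chart_source ℂ _)).1.differentiableWithinAt

/-- Two points of a fibre of `p` differ by a deck transformation `γ`, under which quadratic
differentials change by the factor `γ' ^ 2 = exp m`. -/
theorem IsHolomorphicCovering.exists_deck (hp : IsHolomorphicCovering p)
    {τ₁ τ₂ : ℍ} (h : p τ₁ = p τ₂) :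
    ∃ (γ : C(ℍ, ℍ)) (m : ℂ → ℂ), (∀ τ, p (γ τ) = p τ) ∧ γ τ₁ = τ₂ ∧
      ContinuousOn m {z | 0 < z.im} ∧
      (∀ z w : ℂ, 0 < z.im → 0 < w.im → |(m z).im - (m w).im| < 4 * Real.pi) ∧
      ∀ (φ : BersSpace S) (τ : ℍ),
        pullbackDifferential p φ τ = pullbackDifferential p φ (γ τ) * exp (m τ) := by
  have hpc := hp.1.continuous
  obtain ⟨γ, ⟨hγ1, hγp⟩, -⟩ := hp.1.existsUnique_continuousMap_lifts ⟨p, hpc⟩ τ₁ τ₂ h.symm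
  obtain ⟨δ, ⟨hδ1, hδp⟩, -⟩ := hp.1.existsUnique_continuousMap_lifts ⟨p, hpc⟩ τ₂ τ₁ h
  have hγ : ∀ τ, p (γ τ) = p τ := congrFun hγp
  have hδ : ∀ τ, p (δ τ) = p τ := congrFun hδp
  -- Both sides lift `p` through itself and agree at τ₁.
  have hδγ : (δ ∘ γ : ℍ → ℍ) = id := by
    refine hp.1.eq_of_comp_eq (by fun_prop) continuous_id ?_ τ₁ (by simp [hγ1, hδ1])
    ext τ
    simp [hδ, hγ]
  obtain ⟨m, hm, hexp, hvar⟩ := exists_log_deriv_sq_automorphism (hp.differentiableOn_deck hγ)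
    (hp.differentiableOn_deck hδ) (fun z _ => (γ _).im_pos) (fun z _ => (δ _).im_pos)
    (fun z hz => by
      have := congrFun hδγ (UpperHalfPlane.ofComplex z)
      simp only [Function.comp_apply, id] at this
      rw [UpperHalfPlane.ofComplex_apply, this, coe_ofComplex hz])
  refine ⟨γ, m, hγ, hγ1, hm, hvar, fun φ τ => ?_⟩
  have he := chart_mem_atlas ℂ (p τ)
  have hτe : p (UpperHalfPlane.ofComplex τ) ∈ (chartAt ℂ (p τ)).source := by
    rw [UpperHalfPlane.ofComplex_apply]
    exact mem_chart_source ℂ _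
  have hγe : p (UpperHalfPlane.ofComplex (γ τ)) ∈ (chartAt ℂ (p τ)).source := by
    rw [UpperHalfPlane.ofComplex_apply, hγ]
    exact mem_chart_source ℂ _
  rw [hp.pullbackDifferential_eq φ he τ.im_pos hτe, hexp _ τ.im_pos,
    hp.pullbackDifferential_eq φ he (γ τ).im_pos hγe,
    (hp.hasDerivAt_deck hγ he τ.im_pos hτe).2]
  simp only [localExpr, UpperHalfPlane.ofComplex_apply, hγ]
  ring

theorem IsHolomorphicCovering.pullbackDifferential_eq_zero_iff (hp : IsHolomorphicCovering p)
    (φ : BersSpace S) {τ₁ τ₂ : ℍ}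
    (h : p τ₁ = p τ₂) : pullbackDifferential p φ τ₁ = 0 ↔ pullbackDifferential p φ τ₂ = 0 := by
  obtain ⟨γ, m, -, hγ, -, -, hφ⟩ := hp.exists_deck h
  rw [hφ φ τ₁, hγ]
  simp

end Covering

/-! ### Moving points of a surface by homeomorphisms -/

/-- Adding to the identity a cone-shaped bump times z₁ - z₀ is a perturbation with Lipschitz
constant ‖z₁ - z₀‖ / r < 1. -/
theorem exists_homeomorph_plane {z₀ z₁ : ℂ} {r : ℝ} (h : z₁ ∈ ball z₀ r) :
    ∃ H : ℂ ≃ₜ ℂ, H z₀ = z₁ ∧ ∀ z ∉ ball z₀ r, H z = z := by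
  have hr : 0 < r := pos_of_mem_ball h
  set f : ℂ → ℂ := fun u => u + (max 0 (1 - ‖u - z₀‖ / r) : ℝ) * (z₁ - z₀) with hf
  have hlip : ApproximatesLinearOn f (ContinuousLinearEquiv.refl ℂ ℂ : ℂ →L[ℂ] ℂ) univ
      (‖z₁ - z₀‖₊ / r.toNNReal) := fun u _ v _ => by
    have h1 : f u - f v - (ContinuousLinearEquiv.refl ℂ ℂ : ℂ →L[ℂ] ℂ) (u - v) =
        ((max 0 (1 - ‖u - z₀‖ / r) - max 0 (1 - ‖v - z₀‖ / r) : ℝ) : ℂ) * (z₁ - z₀) := by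
      simp only [hf, ContinuousLinearEquiv.coe_refl, ContinuousLinearMap.coe_id', id]
      push_cast
      ring
    have h2 : |max 0 (1 - ‖u - z₀‖ / r) - max 0 (1 - ‖v - z₀‖ / r)| ≤ ‖u - v‖ / r := by
      rw [max_comm 0, max_comm 0]
      refine (abs_max_sub_max_le_abs (1 - ‖u - z₀‖ / r) (1 - ‖v - z₀‖ / r) 0).trans ?_
      rw [show 1 - ‖u - z₀‖ / r - (1 - ‖v - z₀‖ / r) = -((‖u - z₀‖ - ‖v - z₀‖) / r) by ring,
        abs_neg, abs_div, abs_of_pos hr]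
      gcongr
      refine (abs_norm_sub_norm_le _ _).trans ?_
      rw [sub_sub_sub_cancel_right]
    rw [h1, norm_mul, norm_real, Real.norm_eq_abs, NNReal.coe_div, coe_nnnorm,
      Real.coe_toNNReal _ hr.le]
    calc _ ≤ ‖u - v‖ / r * ‖z₁ - z₀‖ := by gcongr
      _ = _ := by ring
  have hc : ‖z₁ - z₀‖₊ / r.toNNReal <
      ‖((ContinuousLinearEquiv.refl ℂ ℂ).symm : ℂ →L[ℂ] ℂ)‖₊⁻¹ := by
    have : ‖((ContinuousLinearEquiv.refl ℂ ℂ).symm : ℂ →L[ℂ] ℂ)‖₊ = 1 := by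
      ext
      simp
    rw [this, inv_one, ← NNReal.coe_lt_coe, NNReal.coe_div, coe_nnnorm, Real.coe_toNNReal _ hr.le,
      NNReal.coe_one, div_lt_one hr]
    simpa [dist_eq_norm] using h
  refine ⟨hlip.toHomeomorph f (Or.inr hc), ?_, fun z hz => ?_⟩
  · change f z₀ = z₁
    simp [hf]
  · change f z = z
    rw [mem_ball, dist_eq_norm, not_lt, ← one_le_div hr] at hz
    simp [hf, max_eq_left (show 1 - ‖z - z₀‖ / r ≤ 0 by linarith)]

section ChartExtension

variable {S : Type*} [TopologicalSpace S]

open Classical in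
/-- The extension by the identity of a map of the plane seen through a chart. -/
noncomputable def extendThroughChart (e : OpenPartialHomeomorph S ℂ) (G : ℂ → ℂ) (y : S) : S :=
  if y ∈ e.source then e.symm (G (e y)) else y

variable {e : OpenPartialHomeomorph S ℂ} {G H : ℂ → ℂ} {K : Set ℂ}

/-- In a Hausdorff space the compact image of `K` is closed, so the map is the identity near every
point outside the chart domain. -/
theorem continuous_extendThroughChart [T2Space S] (hG : Continuous G) (hK : IsCompact K)
    (hKe : K ⊆ e.target) (hfix : ∀ z ∉ K, G z = z) (hmap : MapsTo G e.target e.target) :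
    Continuous (extendThroughChart e G) := by
  rw [continuous_iff_continuousAt]
  intro y
  by_cases hy : y ∈ e.source
  · have hc : ContinuousAt (fun y => e.symm (G (e y))) y :=
      ContinuousAt.comp (g := e.symm) (f := fun y => G (e y))
        (e.continuousAt_symm (hmap (e.map_source hy)))
        (ContinuousAt.comp (g := G) (f := e) hG.continuousAt (e.continuousAt hy))
    refine hc.congr ?_
    filter_upwards [e.open_source.mem_nhds hy] with x hx
    rw [extendThroughChart, if_pos hx]
  · have hcl : IsClosed (e.symm '' K) :=
      (hK.image_of_continuousOn (e.continuousOn_symm.mono hKe)).isClosed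
    have hyK : y ∉ e.symm '' K := by
      rintro ⟨z, hz, rfl⟩
      exact hy (e.map_target (hKe hz))
    refine continuousAt_id.congr ?_
    filter_upwards [hcl.isOpen_compl.mem_nhds hyK] with x hx
    rw [extendThroughChart]
    split_ifs with hxe
    · rw [hfix (e x) fun h => hx ⟨e x, h, e.left_inv hxe⟩, e.left_inv hxe, id]
    · rfl

theorem extendThroughChart_extendThroughChart (hmap : MapsTo G e.target e.target)
    (hHG : ∀ z, H (G z) = z) (y : S) :
    extendThroughChart e H (extendThroughChart e G y) = y := by
  by_cases hy : y ∈ e.source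
  · have h1 := hmap (e.map_source hy)
    have h2 : extendThroughChart e G y = e.symm (G (e y)) := if_pos hy
    rw [h2, extendThroughChart, if_pos (e.map_target h1), e.right_inv h1, hHG, e.left_inv hy]
  · simp [extendThroughChart, hy]

end ChartExtension

section Surface

variable {S : Type*} [TopologicalSpace S] [T2Space S] [ChartedSpace ℂ S] {D : Set S}

theorem exists_homeomorph_apply_mem_of_dense (hD : Dense D) {x : S} {U : Set S} (hU : U ∈ 𝓝 x) :
    ∃ h : S ≃ₜ S, h x ∈ D ∧ ∀ y ∉ U, h y = y := by
  set e := chartAt ℂ x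
  have hx : x ∈ e.source := mem_chart_source ℂ x
  have hnhds : e.target ∩ e.symm ⁻¹' U ∈ 𝓝 (e x) := by
    refine inter_mem (e.open_target.mem_nhds (e.map_source hx)) ?_
    have := e.symm.continuousAt (e.map_source hx)
    rw [ContinuousAt, e.left_inv hx] at this
    exact this hU
  obtain ⟨r, hr, hball⟩ := Metric.nhds_basis_closedBall.mem_iff.1 hnhds
  have hballt : ball (e x) r ⊆ e.target := fun z hz => (hball (ball_subset_closedBall hz)).1
  have hopen : IsOpen (e.symm '' ball (e x) r) :=
    e.symm.isOpen_image_of_subset_source isOpen_ball hballt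
  obtain ⟨_, ⟨z₁, hz₁, rfl⟩, hz₁D⟩ := hD.inter_open_nonempty _ hopen
    ((nonempty_ball.2 hr).image _)
  obtain ⟨H, hH, hfix⟩ := exists_homeomorph_plane hz₁
  have hfix' : ∀ z ∉ ball (e x) r, H.symm z = z := fun z hz => by
    rw [Homeomorph.symm_apply_eq, hfix z hz]
  -- A point of the ball cannot leave it: its image would be a fixed point, against injectivity.
  have hmaps : ∀ H : ℂ ≃ₜ ℂ, (∀ z ∉ ball (e x) r, H z = z) → MapsTo H e.target e.target := by
    intro H hfix z hz
    by_cases hzb : z ∈ ball (e x) r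
    · refine hballt ?_
      by_contra hHz
      have h1 := H.injective (hfix _ hHz)
      exact hHz (h1.symm ▸ hzb)
    · rwa [hfix z hzb]
  have hcont : ∀ H : ℂ ≃ₜ ℂ, (∀ z ∉ ball (e x) r, H z = z) →
      Continuous (extendThroughChart e H) := fun H hfix =>
    continuous_extendThroughChart H.continuous (isCompact_closedBall (e x) r)
      (fun z hz => (hball hz).1) (fun z hz => hfix z fun h => hz (ball_subset_closedBall h))
      (hmaps H hfix)
  refine ⟨⟨⟨extendThroughChart e H, extendThroughChart e H.symm,
    extendThroughChart_extendThroughChart (hmaps H hfix) H.symm_apply_apply,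
    extendThroughChart_extendThroughChart (hmaps H.symm hfix') H.apply_symm_apply⟩,
    hcont H hfix, hcont H.symm hfix'⟩, ?_, fun y hy => ?_⟩
  · change extendThroughChart e H x ∈ D
    rwa [extendThroughChart, if_pos hx, hH]
  · change extendThroughChart e H y = y
    rw [extendThroughChart]
    split_ifs with hye
    · rw [hfix, e.left_inv hye]
      intro h
      refine hy ?_
      have := (hball (ball_subset_closedBall h)).2
      rwa [mem_preimage, e.left_inv hye] at this
    · rfl

/-- A finite set of points of a surface can be moved into a dense set by a homeomorphism. -/
theorem exists_homeomorph_image_subset_of_dense (hD : Dense D) {Z : Set S} (hZ : Z.Finite) :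
    ∃ h : S ≃ₜ S, ∀ z ∈ Z, h z ∈ D := by
  induction Z, hZ using Set.Finite.induction_on with
  | empty => exact ⟨Homeomorph.refl S, by simp⟩
  | @insert a Z ha hZ ih =>
    obtain ⟨k, hk⟩ := ih
    -- Moving k a inside this neighbourhood leaves the points already placed in `D` fixed.
    have hU : (k '' Z)ᶜ ∈ 𝓝 (k a) := (hZ.image k).isClosed.isOpen_compl.mem_nhds fun h =>
      ha (k.injective.mem_set_image.1 h)
    obtain ⟨h, hha, hfix⟩ := exists_homeomorph_apply_mem_of_dense hD hU
    refine ⟨k.trans h, fun z hz => ?_⟩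
    rcases hz with rfl | hz
    · exact hha
    · rw [Homeomorph.trans_apply, hfix (k z) fun h => h ⟨z, hz, rfl⟩]
      exact hk z hz

end Surface

/-! ### The polygon model of a closed surface -/

section Model

variable {g : ℕ}

theorem norm_polygonBoundary (s : ℝ) : ‖(polygonBoundary g s : ℂ)‖ = 1 :=
  norm_exp_ofReal_mul_I _

theorem unitCircle_div_eq_polygonBoundary (s : ℝ) :
    unitCircle (s / (4 * g)) = polygonBoundary g s := by
  simp only [unitCircle, polygonBoundary, mul_div_assoc]

theorem continuous_modelSurface_mk :
    Continuous (Quot.mk (SidePairing g) : closedBall (0 : ℂ) 1 → ModelSurface g) :=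
  continuous_quot_mk

/-- Interior points of the polygon are not identified with other points. -/
theorem modelSurface_mk_injective_of_norm_lt {z w : closedBall (0 : ℂ) 1} (hw : ‖(w : ℂ)‖ < 1)
    (h : (Quot.mk (SidePairing g) z : ModelSurface g) = Quot.mk (SidePairing g) w) : z = w := by
  classical
  -- Paired points both lie on the circle, so sending the boundary to `none` descends to the
  -- quotient and still separates interior points.
  let inner : ModelSurface g → Option (closedBall (0 : ℂ) 1) :=
    Quot.lift (fun u => if ‖(u : ℂ)‖ < 1 then some u else none) fun a b hab => by
      cases hab <;> simp [norm_polygonBoundary]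
  have h' : (if ‖(z : ℂ)‖ < 1 then some z else none) =
      (if ‖(w : ℂ)‖ < 1 then some w else none) := congrArg inner h
  rw [if_pos hw] at h'
  split_ifs at h'
  exact Option.some_injective _ h'

theorem dense_modelSurface_interior :
    Dense ((Quot.mk (SidePairing g) : closedBall (0 : ℂ) 1 → ModelSurface g) ''
      {w | ‖(w : ℂ)‖ < 1}) := by
  refine DenseRange.dense_image Quot.mk_surjective.denseRange continuous_modelSurface_mk ?_
  rw [Subtype.dense_iff]
  intro w hw
  have : (Subtype.val '' {w : closedBall (0 : ℂ) 1 | ‖(w : ℂ)‖ < 1}) = ball (0 : ℂ) 1 := by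
    ext v
    simp only [mem_image, mem_ofPred_eq, Subtype.exists, mem_closedBall_zero_iff, mem_ball_zero_iff]
    exact ⟨fun ⟨a, _, h, hv⟩ => hv ▸ h, fun h => ⟨v, h.le, h, rfl⟩⟩
  rw [this, closure_ball _ one_ne_zero]
  exact hw

/-- The radial retraction of the plane onto the closed unit disc. -/
noncomputable def discRetraction (z : ℂ) : closedBall (0 : ℂ) 1 :=
  ⟨((max 1 ‖z‖)⁻¹ : ℝ) * z, by
    have h : 0 < max 1 ‖z‖ := lt_max_of_lt_left one_pos
    rw [mem_closedBall_zero_iff, norm_mul, norm_real, Real.norm_eq_abs, abs_of_pos (inv_pos.2 h),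
      inv_mul_le_one₀ h]
    exact le_max_right _ _⟩

theorem continuous_discRetraction : Continuous discRetraction := by
  refine Continuous.subtype_mk ?_ _
  have : Continuous fun z : ℂ => (max 1 ‖z‖)⁻¹ :=
    Continuous.inv₀ (by fun_prop) fun z => (lt_max_of_lt_left one_pos).ne'
  fun_prop

theorem discRetraction_coe (w : closedBall (0 : ℂ) 1) : discRetraction w = w := by
  have := mem_closedBall_zero_iff.1 w.2
  ext
  simp [discRetraction, max_eq_left this]

variable {S : Type*} [TopologicalSpace S]

/-- A parametrization of a covered surface by the polygon lifts to the covering. -/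
theorem exists_lift_disc [PreconnectedSpace S] {p : ℍ → S} (hp : IsCoveringMap p)
    {f : closedBall (0 : ℂ) 1 → S} (hf : Continuous f) :
    ∃ F : ℂ → ℍ, Continuous F ∧ (∀ w : closedBall (0 : ℂ) 1, p (F w) = f w) ∧
      ∀ z, ∃ w : closedBall (0 : ℂ) 1, F z = F w := by
  obtain ⟨τ, hτ⟩ := hp.surjective_of_connectedSpace (f (discRetraction 0))
  obtain ⟨F, ⟨-, hF⟩, -⟩ := hp.existsUnique_continuousMap_lifts
    ⟨fun z => f (discRetraction z), hf.comp continuous_discRetraction⟩ 0 τ hτ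
  have hF' : ∀ z, p (F z) = f (discRetraction z) := congrFun hF
  refine ⟨fun z => F (discRetraction z),
    F.continuous.comp (continuous_subtype_val.comp continuous_discRetraction), fun w => ?_,
    fun z => ⟨discRetraction z, ?_⟩⟩
  · rw [hF', discRetraction_coe, discRetraction_coe]
  · simp only [discRetraction_coe]

end Model

/-! ### The winding number of a quadratic differential along the polygon -/

/-- A function on the boundary of a `4g`-gon whose values on paired sides differ by factors with a
small variation of the argument has a small winding number. -/
theorem abs_windingNumber_lt_of_paired_sides {g : ℕ} (hg : 0 < g) {u : ℝ → ℂ} {n : ℤ}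
    (hn : HasWindingNumber (fun s => u (4 * g * s)) n)
    (ha : ∀ j < g, ∃ M : ℝ → ℂ, Continuous M ∧ |(M 1).im - (M 0).im| < 4 * Real.pi ∧
      ∀ t ∈ Icc (0 : ℝ) 1, u (4 * j + t) = u (4 * j + 3 - t) * exp (M t))
    (hb : ∀ j < g, ∃ M : ℝ → ℂ, Continuous M ∧ |(M 1).im - (M 0).im| < 4 * Real.pi ∧
      ∀ t ∈ Icc (0 : ℝ) 1, u (4 * j + 1 + t) = u (4 * j + 4 - t) * exp (M t)) :
    |n| < 4 * g := by
  have hg' : (0 : ℝ) < g := by exact_mod_cast hg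
  obtain ⟨ℓ, hℓ, hexp, hinc⟩ := hn
  set L : ℝ → ℂ := fun s => ℓ (s / (4 * g)) with hL
  have hLc : Continuous L := by fun_prop
  have hLexp : ∀ s, exp (L s) = u s := fun s => by
    have h : 4 * (g : ℝ) * (s / (4 * g)) = s := by field_simp
    simp only [hL, hexp, h]
  -- The paired side is traversed backwards from b to b - 1; along the two sides the logarithms
  -- differ by `M` up to a constant.
  have hpair : ∀ (a b : ℝ) (M : ℝ → ℂ), Continuous M →
      (∀ t ∈ Icc (0 : ℝ) 1, u (a + t) = u (b - t) * exp (M t)) →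
      L (a + 1) - L a = L (b - 1) - L b + (M 1 - M 0) := by
    intro a b M hM h
    have := sub_eq_sub_of_exp_eq (X := Icc (0 : ℝ) 1) (ℓ₁ := fun t => L (a + t))
      (ℓ₂ := fun t => L (b - t) + M t) (by fun_prop) (by fun_prop)
      (fun t => by rw [exp_add, hLexp, hLexp, h t t.2]) 1 0
    simp only [Icc.coe_one, Icc.coe_zero, add_zero, sub_zero] at this
    linear_combination this
  have hblock : ∀ j < g, |(L (4 * (j + 1 : ℕ)) - L (4 * j)).im| < 8 * Real.pi := by
    intro j hj
    obtain ⟨M, hM, hMv, hMu⟩ := ha j hj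
    obtain ⟨N, hN, hNv, hNu⟩ := hb j hj
    have h1 := hpair _ _ M hM hMu
    have h2 := hpair _ _ N hN hNu
    rw [show (4 * j + 3 - 1 : ℝ) = 4 * j + 2 by ring] at h1
    rw [show (4 * j + 4 - 1 : ℝ) = 4 * j + 3 by ring,
      show (4 * j + 1 + 1 : ℝ) = 4 * j + 2 by ring] at h2
    -- The increments along a and a⁻¹, and along b and b⁻¹, cancel up to the variations of `M` and
    -- `N`.
    have h3 : L (4 * (j + 1 : ℕ)) - L (4 * j) = (M 1 - M 0) + (N 1 - N 0) := by
      rw [show (4 * (j + 1 : ℕ) : ℝ) = 4 * j + 4 by push_cast; ring]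
      linear_combination h1 + h2
    rw [h3, add_im, sub_im, sub_im]
    refine (abs_add_le _ _).trans_lt ?_
    linarith
  have htot : (n : ℂ) * (2 * Real.pi * I) =
      ∑ j ∈ Finset.range g, (L (4 * (j + 1 : ℕ)) - L (4 * j)) := by
    rw [Finset.sum_range_sub (fun j : ℕ => L (4 * j)), ← hinc, hL]
    simp only
    rw [div_self (by positivity)]
    simp
  have him : (n : ℝ) * (2 * Real.pi) =
      ∑ j ∈ Finset.range g, (L (4 * (j + 1 : ℕ)) - L (4 * j)).im := by
    rw [← im_sum, ← htot]
    simp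
  have hlt : |(n : ℝ)| * (2 * Real.pi) < g * (8 * Real.pi) := by
    rw [← abs_of_pos Real.two_pi_pos, ← abs_mul, him]
    calc _ ≤ ∑ j ∈ Finset.range g, |(L (4 * (j + 1 : ℕ)) - L (4 * j)).im| :=
          Finset.abs_sum_le_sum_abs _ _
      _ < ∑ j ∈ Finset.range g, 8 * Real.pi :=
          Finset.sum_lt_sum_of_nonempty (Finset.nonempty_range_iff.2 hg.ne')
            fun j hj => hblock j (Finset.mem_range.1 hj)
      _ = _ := by simp
  have : |(n : ℝ)| < 4 * g := by
    have := Real.pi_pos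
    by_contra! hle
    nlinarith
  exact_mod_cast this

section Zeros

variable {S : Type*} [TopologicalSpace S] [ChartedSpace ℂ S] [IsManifold 𝓘(ℂ) 1 S] {p : ℍ → S}

/-- The deck transformation matching the starting points matches the whole paths, by uniqueness of
lifts. -/
theorem IsHolomorphicCovering.exists_factor_along_paths (hp : IsHolomorphicCovering p)
    {a b : ℝ → ℍ} (ha : Continuous a) (hb : Continuous b)
    (hab : ∀ t ∈ Icc (0 : ℝ) 1, p (a t) = p (b t)) :
    ∃ M : ℝ → ℂ, Continuous M ∧ |(M 1).im - (M 0).im| < 4 * Real.pi ∧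
      ∀ (φ : BersSpace S), ∀ t ∈ Icc (0 : ℝ) 1,
        pullbackDifferential p φ (a t) = pullbackDifferential p φ (b t) * exp (M t) := by
  have h0 : (0 : ℝ) ∈ Icc (0 : ℝ) 1 := by simp
  obtain ⟨γ, m, hγ, hγ0, hm, hvar, hφ⟩ := hp.exists_deck (hab 0 h0)
  have heq : EqOn (fun t => γ (a t)) b (Icc 0 1) :=
    hp.1.eqOn_of_comp_eqOn isPreconnected_Icc (by fun_prop) hb.continuousOn
      (fun t ht => by simp [hγ, hab t ht]) h0 hγ0
  refine ⟨fun t => m (a t), ?_, hvar _ _ (a 1).im_pos (a 0).im_pos, fun φ t ht => ?_⟩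
  · exact hm.comp_continuous (UpperHalfPlane.continuous_coe.comp ha) fun t => (a t).im_pos
  · have hγt : γ (a t) = b t := heq ht
    rw [hφ, hγt]

/-- A nonzero quadratic differential on a closed surface of genus `g` has less than `4g` zeros. -/
theorem IsHolomorphicCovering.card_zeros_lt [T2Space S] [PreconnectedSpace S]
    (hp : IsHolomorphicCovering p) {g : ℕ} (hg : 0 < g) (f : ModelSurface g ≃ₜ S)
    {φ : BersSpace S} (hφ : φ ≠ 0) {T : Finset S}
    (hT : ∀ x ∈ T, φ.coeff ⟨chartAt ℂ x, chart_mem_atlas ℂ x⟩ (chartAt ℂ x x) = 0) :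
    T.card < 4 * g := by
  classical
  set mk : closedBall (0 : ℂ) 1 → ModelSurface g := Quot.mk (SidePairing g)
  have hmk : Continuous mk := continuous_modelSurface_mk
  have hsurj : Function.Surjective mk := Quot.mk_surjective
  have han := hp.analyticOnNhd_pullbackDifferential φ
  have hne := hp.exists_pullbackDifferential_ne_zero hφ
  -- A preliminary lift of the polygon is a compact set meeting every fibre, so finitely many zeros
  -- upstairs represent all zeros on S.
  have hfin : {x : S | ∃ τ : ℍ, p τ = x ∧ pullbackDifferential p φ τ = 0}.Finite := by
    obtain ⟨F, hF, hFp, -⟩ := exists_lift_disc hp.1 (f.continuous.comp hmk)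
    have hK : IsCompact ((fun z => (F z : ℂ)) '' closedBall (0 : ℂ) 1) :=
      (isCompact_closedBall _ _).image (UpperHalfPlane.continuous_coe.comp hF)
    have := finite_zeros_of_isCompact han isPreconnected_im_pos hne hK
      (by rintro _ ⟨z, -, rfl⟩; exact (F z).im_pos)
    refine (this.image fun w => p (UpperHalfPlane.ofComplex w)).subset ?_
    rintro _ ⟨τ, rfl, hτ⟩
    obtain ⟨y, hy⟩ := f.surjective (p τ)
    obtain ⟨w, rfl⟩ := hsurj y
    have hpF : p (F w) = p τ := (hFp w).trans hy
    refine ⟨F w, ⟨⟨w, w.2, rfl⟩, ?_⟩, ?_⟩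
    · rwa [hp.pullbackDifferential_eq_zero_iff φ hpF]
    · simp only [UpperHalfPlane.ofComplex_apply, hpF]
  obtain ⟨h, hh⟩ := exists_homeomorph_image_subset_of_dense
    (f.surjective.denseRange.dense_image f.continuous dense_modelSurface_interior) hfin
  -- Undoing `h` after `f` gives a parametrization in which every zero comes from an interior point
  -- of the polygon.
  set f' := f.trans h.symm
  obtain ⟨F, hF, hFp, hFr⟩ := exists_lift_disc hp.1 (f'.continuous.comp hmk)
  have hFc : Continuous fun z => (F z : ℂ) := UpperHalfPlane.continuous_coe.comp hF
  have hFinj : ∀ z ∈ closedBall (0 : ℂ) 1, ∀ w ∈ ball (0 : ℂ) 1, (F z : ℂ) = F w → z = w := by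
    intro z hz w hw hzw
    have h1 := congrArg p (UpperHalfPlane.ext_iff.2 (by exact hzw) : F z = F w)
    have h2 := hFp ⟨z, hz⟩
    have h3 := hFp ⟨w, ball_subset_closedBall hw⟩
    simp only at h2 h3
    rw [h2, h3] at h1
    exact congrArg Subtype.val (modelSurface_mk_injective_of_norm_lt (by simpa using hw)
      (f'.injective h1))
  have hcirc : ∀ s, unitCircle s ∈ closedBall (0 : ℂ) 1 := fun s => by simp
  have hbd : ∀ s, pullbackDifferential p φ (F (unitCircle s)) ≠ 0 := by
    intro s h0
    obtain ⟨_, ⟨w, hw, rfl⟩, hw'⟩ := hh _ ⟨_, rfl, h0⟩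
    have h1 : p (F (unitCircle s)) = f' (mk ⟨unitCircle s, hcirc s⟩) := hFp ⟨_, hcirc s⟩
    rw [h1, Homeomorph.trans_apply, h.apply_symm_apply] at hw'
    have h2 := modelSurface_mk_injective_of_norm_lt hw (f.injective hw').symm
    have h3 : ‖(w : ℂ)‖ < 1 := hw
    rw [← h2, norm_unitCircle] at h3
    exact lt_irrefl _ h3
  have hcont : Continuous fun s => pullbackDifferential p φ (F (unitCircle s)) :=
    han.continuousOn.comp_continuous (hFc.comp continuous_unitCircle) fun s => (F _).im_pos
  obtain ⟨n, hn⟩ := HasWindingNumber.exists_of_continuous hcont hbd (by rw [unitCircle_one])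
  have hg' : (0 : ℝ) < 4 * g := by positivity
  set lam : ℝ → ℍ := fun s => F (polygonBoundary g s) with hlam
  have hlam' : ∀ s, lam s = F (unitCircle (s / (4 * g))) := fun s => by
    rw [unitCircle_div_eq_polygonBoundary]
  have hlamc : Continuous lam := by
    rw [funext hlam']
    exact hF.comp (continuous_unitCircle.comp (by fun_prop))
  have hnlt : |n| < 4 * g := by
    refine abs_windingNumber_lt_of_paired_sides hg
      (u := fun s => pullbackDifferential p φ (lam s)) ?_ (fun j hj => ?_) fun j hj => ?_
    · simpa only [hlam', mul_div_cancel_left₀ _ hg'.ne'] using hn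
    · obtain ⟨M, hM, hv, hMφ⟩ := hp.exists_factor_along_paths (a := fun t => lam (4 * j + t))
        (b := fun t => lam (4 * j + 3 - t)) (by fun_prop) (by fun_prop)
        (fun t ht => by
          simp only [hlam, hFp, Function.comp_apply]
          exact congrArg f' (Quot.sound (SidePairing.a j hj t ht)))
      exact ⟨M, hM, hv, hMφ φ⟩
    · obtain ⟨M, hM, hv, hMφ⟩ := hp.exists_factor_along_paths (a := fun t => lam (4 * j + 1 + t))
        (b := fun t => lam (4 * j + 4 - t)) (by fun_prop) (by fun_prop)
        (fun t ht => by
          simp only [hlam, hFp, Function.comp_apply]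
          exact congrArg f' (Quot.sound (SidePairing.b j hj t ht)))
      exact ⟨M, hM, hv, hMφ φ⟩
  have hpre : ∀ x : S, ∃ w : closedBall (0 : ℂ) 1, p (F w) = x := fun x => by
    obtain ⟨y, hy⟩ := f'.surjective x
    obtain ⟨w, rfl⟩ := hsurj y
    exact ⟨w, (hFp w).trans hy⟩
  choose W hW using hpre
  have hinjW : Function.Injective fun x => (W x : ℂ) := fun x y hxy => by
    rw [← hW x, ← hW y]
    exact congrArg (fun z => p (F z)) hxy
  have hcard := card_zeros_le_abs_windingNumber hFc hFinj han isPreconnected_im_pos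
    (fun z => (F z).im_pos)
    (fun z => by obtain ⟨w, hw⟩ := hFr z; exact ⟨w, w.2, by simp only [hw]⟩) hbd
    (T := T.image fun x => (W x : ℂ)) (fun w hw => by
      obtain ⟨x, hx, rfl⟩ := Finset.mem_image.1 hw
      refine ⟨(W x).2, ?_⟩
      have := hT x hx
      simp only [pullbackDifferential, localExpr, UpperHalfPlane.ofComplex_apply, hW]
      rw [this, zero_mul]) hn
  rw [Finset.card_image_of_injective _ hinjW] at hcard
  omega

end Zeros

/-! ### Covering numbers of balls in finite-dimensional spaces -/

section Volume

open MeasureTheory Module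

/-- The balls of radius r/2 about the points are disjoint and lie in the ball of radius R + r/2; the
bound is the ratio of Haar volumes. -/
theorem card_le_of_separated_of_norm_lt {E : Type*} [NormedAddCommGroup E] [NormedSpace ℝ E]
    [FiniteDimensional ℝ E] {R r : ℝ} (hR : 0 < R) (hr : 0 < r) (T : Finset E)
    (hT : ∀ c ∈ T, ‖c‖ < R) (hsep : ∀ c ∈ T, ∀ d ∈ T, c ≠ d → r ≤ ‖c - d‖) :
    (T.card : ℝ) ≤ (2 * R / r + 1) ^ finrank ℝ E := by
  borelize E
  let μ : Measure E := Measure.addHaar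
  have hρ : 0 < R + r / 2 := by positivity
  have hdisj : (T : Set E).Pairwise (Function.onFun Disjoint fun c => ball c (r / 2)) := by
    intro c hc d hd hcd
    refine ball_disjoint_ball ?_
    rw [dist_eq_norm, add_halves]
    exact hsep c hc d hd hcd
  have hsub : ⋃ c ∈ T, ball c (r / 2) ⊆ ball (0 : E) (R + r / 2) :=
    iUnion₂_subset fun c hc => ball_subset_ball' (by
      rw [dist_zero_right]
      linarith [hT c hc])
  have hvol : (T.card : ℝ≥0∞) * ENNReal.ofReal ((r / 2) ^ finrank ℝ E) * μ (ball 0 1) ≤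
      ENNReal.ofReal ((R + r / 2) ^ finrank ℝ E) * μ (ball 0 1) :=
    calc _ = μ (⋃ c ∈ T, ball c (r / 2)) := by
          rw [measure_biUnion_finset hdisj fun c _ => measurableSet_ball]
          simp only [μ.addHaar_ball_of_pos _ (half_pos hr), Finset.sum_const, nsmul_eq_mul,
            mul_assoc]
      _ ≤ μ (ball 0 (R + r / 2)) := measure_mono hsub
      _ = _ := μ.addHaar_ball_of_pos _ hρ
  have hcard := ENNReal.toReal_le_of_le_ofReal (pow_nonneg hρ.le _)
    ((ENNReal.mul_le_mul_iff_left (measure_ball_pos μ _ zero_lt_one).ne'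
      measure_ball_lt_top.ne).1 hvol)
  rw [ENNReal.toReal_mul, ENNReal.toReal_natCast, ENNReal.toReal_ofReal (by positivity),
    ← le_div_iff₀ (by positivity), ← div_pow] at hcard
  have hquot : 2 * R / r + 1 = (R + r / 2) / (r / 2) := by field_simp
  rwa [hquot]

/-- Passing to the separation quotient preserves norms, keeps separated points distinct and does not
raise the dimension. -/
theorem card_le_of_separated_of_seminorm_lt {E : Type*} [SeminormedAddCommGroup E]
    [NormedSpace ℝ E] [FiniteDimensional ℝ E] {R r : ℝ} (hR : 0 < R) (hr : 0 < r) (T : Finset E)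
    (hT : ∀ c ∈ T, ‖c‖ < R) (hsep : ∀ c ∈ T, ∀ d ∈ T, c ≠ d → r ≤ ‖c - d‖) :
    (T.card : ℝ) ≤ (2 * R / r + 1) ^ finrank ℝ E := by
  classical
  let π : E →ₗ[ℝ] SeparationQuotient E := SeparationQuotient.mkCLM ℝ E
  have hπ : Function.Surjective π := SeparationQuotient.surjective_mk
  have hnorm : ∀ x, ‖π x‖ = ‖x‖ := SeparationQuotient.norm_mk
  have : FiniteDimensional ℝ (SeparationQuotient E) := Module.Finite.of_surjective π hπ
  have hinj : Set.InjOn π T := fun c hc d hd hcd => by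
    by_contra hne
    have h1 := hsep c hc d hd hne
    rw [← hnorm, map_sub, hcd, sub_self, norm_zero] at h1
    linarith
  have h := card_le_of_separated_of_norm_lt hR hr (T.image π)
    (by
      simp only [Finset.mem_image, forall_exists_index, and_imp, forall_apply_eq_imp_iff₂, hnorm]
      exact hT)
    (by
      simp only [Finset.mem_image, forall_exists_index, and_imp, forall_apply_eq_imp_iff₂]
      intro c hc d hd hcd
      rw [← map_sub, hnorm]
      exact hsep c hc d hd fun h => hcd (congrArg π h))
  rw [Finset.card_image_of_injOn hinj] at h
  refine h.trans (pow_le_pow_right₀ ?_ (LinearMap.finrank_le_finrank_of_surjective hπ))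
  have : 0 < 2 * R / r := by positivity
  linarith

/-- The volume bound for separated subsets of a ball of a finite-dimensional space with a seminorm
that may take the value `∞`. -/
theorem card_le_of_separated_of_extended_seminorm_lt {V : Type*} [AddCommGroup V] [Module ℝ V]
    [FiniteDimensional ℝ V] {N : V → ℝ≥0∞} (hadd : ∀ x y, N (x + y) ≤ N x + N y)
    (hsmul : ∀ (a : ℝ) x, N (a • x) = ‖a‖ₑ * N x) {R r : ℝ} (hR : 0 < R) (hr : 0 < r)
    (T : Finset V) (hT : ∀ c ∈ T, N c < ENNReal.ofReal R)
    (hsep : ∀ c ∈ T, ∀ d ∈ T, c ≠ d → ENNReal.ofReal r ≤ N (c - d)) :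
    (T.card : ℝ) ≤ (2 * R / r + 1) ^ finrank ℝ V := by
  classical
  -- The vectors of finite seminorm form a subspace containing `T`, on which the real-valued bound
  -- applies.
  let V₀ : Submodule ℝ V :=
    { carrier := {x | N x < ⊤}
      zero_mem' := by
        have := hsmul 0 0
        simp only [zero_smul, enorm_zero, zero_mul] at this
        simp [this]
      add_mem' := fun {x y} hx hy => (hadd x y).trans_lt (ENNReal.add_lt_top.2 ⟨hx, hy⟩)
      smul_mem' := fun a x hx => by
        change N (a • x) < ⊤
        rw [hsmul]
        exact ENNReal.mul_lt_top enorm_lt_top hx }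
  let : Norm V₀ := ⟨fun x => (N x).toReal⟩
  have hdef : ∀ x : V₀, ‖x‖ = (N x).toReal := fun _ => rfl
  have core : SeminormedSpace.Core ℝ V₀ :=
    { norm_nonneg := fun x => ENNReal.toReal_nonneg
      norm_smul := fun a x => by
        rw [hdef, hdef, Submodule.coe_smul, hsmul, ENNReal.toReal_mul, toReal_enorm]
      norm_triangle := fun x y => by
        rw [hdef, hdef, hdef, ← ENNReal.toReal_add x.2.ne y.2.ne]
        exact ENNReal.toReal_mono (ENNReal.add_lt_top.2 ⟨x.2, y.2⟩).ne (hadd _ _) }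
  let : SeminormedAddCommGroup V₀ := SeminormedAddCommGroup.ofCore core
  let : NormedSpace ℝ V₀ := ⟨fun a x => (core.norm_smul a x).le⟩
  have hmem : ∀ c ∈ T, c ∈ V₀ := fun c hc => (hT c hc).trans ENNReal.ofReal_lt_top
  have h := card_le_of_separated_of_seminorm_lt (E := V₀) hR hr (T.subtype (· ∈ V₀))
    (fun c hc => by
      rw [Finset.mem_subtype] at hc
      have := (ENNReal.toReal_lt_toReal c.2.ne ENNReal.ofReal_ne_top).2 (hT c hc)
      rwa [ENNReal.toReal_ofReal hR.le] at this)
    (fun c hc d hd hcd => by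
      rw [Finset.mem_subtype] at hc hd
      have := ENNReal.toReal_mono (c - d).2.ne (hsep c hc d hd fun h => hcd (Subtype.ext h))
      rwa [ENNReal.toReal_ofReal hr.le] at this)
  rw [Finset.card_subtype, Finset.filter_true_of_mem hmem] at h
  refine h.trans (pow_le_pow_right₀ ?_ (Submodule.finrank_le V₀))
  have : 0 < 2 * R / r := by positivity
  linarith

end Volume

/-- A separated subset of largest cardinality, which exists as `B` bounds all of them, is a set of
centres: an uncovered point could be added to it. -/
theorem coveringNumber_le_of_separated {X : Type*} [PseudoEMetricSpace X] {E : Set X} {r B : ℝ}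
    (hr : 0 < r) (h : ∀ T : Finset X, (∀ c ∈ T, c ∈ E) →
      (∀ c ∈ T, ∀ d ∈ T, c ≠ d → ENNReal.ofReal r ≤ edist c d) → (T.card : ℝ) ≤ B) :
    (coveringNumber E r : ℝ≥0∞) ≤ ENNReal.ofReal B := by
  classical
  let P : ℕ → Prop := fun n => ∃ T : Finset X, T.card = n ∧ (∀ c ∈ T, c ∈ E) ∧
    ∀ c ∈ T, ∀ d ∈ T, c ≠ d → ENNReal.ofReal r ≤ edist c d
  have hP0 : P 0 := ⟨∅, by simp⟩
  obtain ⟨T, hcard, hTE, hsep⟩ := Nat.findGreatest_spec (P := P) (Nat.zero_le ⌊B⌋₊) hP0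
  have hcov : E ⊆ ⋃ x ∈ (T : Set X), Metric.eball x (ENNReal.ofReal r) := by
    intro x hx
    by_contra hnot
    simp only [Finset.mem_coe, mem_iUnion, Metric.mem_eball, not_exists, not_lt] at hnot
    have hxT : x ∉ T := fun hxT => by
      have := hnot x hxT
      simp only [edist_self, nonpos_iff_eq_zero, ENNReal.ofReal_eq_zero] at this
      linarith
    have hsep' : ∀ c ∈ insert x T, ∀ d ∈ insert x T, c ≠ d → ENNReal.ofReal r ≤ edist c d := by
      intro c hc d hd hcd
      rcases Finset.mem_insert.1 hc with hcx | hcT <;> rcases Finset.mem_insert.1 hd with hdx | hdT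
      · exact absurd (hcx.trans hdx.symm) hcd
      · exact hcx ▸ hnot d hdT
      · rw [edist_comm]
        exact hdx ▸ hnot c hcT
      · exact hsep c hcT d hdT hcd
    have hE' : ∀ c ∈ insert x T, c ∈ E := fun c hc => by
      rcases Finset.mem_insert.1 hc with rfl | hc
      exacts [hx, hTE c hc]
    have hle := Nat.le_floor (h _ hE' hsep')
    have := Nat.le_findGreatest (P := P) hle ⟨_, rfl, hE', hsep'⟩
    rw [Finset.card_insert_of_notMem hxT, hcard] at this
    omega
  have h1 : coveringNumber E r ≤ (T : Set X).encard := iInf₂_le (T : Set X) hcov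
  rw [Set.encard_coe_eq_coe_finsetCard] at h1
  calc (coveringNumber E r : ℝ≥0∞) ≤ ((T.card : ℕ∞) : ℝ≥0∞) := by exact_mod_cast h1
    _ = ENNReal.ofReal T.card := by simp
    _ ≤ ENNReal.ofReal B := ENNReal.ofReal_le_ofReal (h T hTE hsep)

/-! ### The dimension of the Bers space -/

section Bers

variable {S : Type*} [TopologicalSpace S] [ChartedSpace ℂ S]

theorem bersNorm_add_le (φ ψ : BersSpace S) : bersNorm (φ + ψ) ≤ bersNorm φ + bersNorm ψ := by
  have h : bersNorm (φ - -ψ) ≤ bersNorm (φ - 0) + bersNorm (0 - -ψ) := edist_triangle φ 0 (-ψ)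
  simpa using h

theorem bersNorm_smul (a : ℝ) (φ : BersSpace S) : bersNorm (a • φ) = ‖a‖ₑ * bersNorm φ := by
  have h : ∀ (e : atlas ℂ S) (z : ℂ), (a • φ).coeff e z = a * φ.coeff e z := fun _ _ => rfl
  have h' : ‖(a : ℂ)‖ₑ = ‖a‖ₑ := by simp [enorm_eq_nnnorm]
  simp only [bersNorm, ENNReal.mul_iSup, h, enorm_mul, h', mul_div_assoc]

/-- Evaluation of quadratic differentials at points, each in its preferred chart. -/
noncomputable def evalAtPoints (T : Finset S) : BersSpace S →ₗ[ℂ] (T → ℂ) where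
  toFun φ x := φ.coeff ⟨chartAt ℂ (x : S), chart_mem_atlas ℂ _⟩ (chartAt ℂ (x : S) x)
  map_add' _ _ := rfl
  map_smul' _ _ := rfl

theorem HasGenus.infinite {S : Type*} [TopologicalSpace S] {g : ℕ} (h : HasGenus S g) :
    Infinite S := by
  obtain ⟨f⟩ := h
  have hlt : ∀ n : ℕ, ‖((1 / (n + 2) : ℝ) : ℂ)‖ < 1 := fun n => by
    rw [norm_real, Real.norm_eq_abs, abs_of_pos (by positivity), div_lt_one (by positivity)]
    have : (0 : ℝ) ≤ n := n.cast_nonneg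
    linarith
  refine Infinite.of_injective (fun n : ℕ => f.symm (Quot.mk _
    ⟨((1 / (n + 2) : ℝ) : ℂ), mem_closedBall_zero_iff.2 (hlt n).le⟩)) fun m n hmn => ?_
  have h1 := congrArg Subtype.val
    (modelSurface_mk_injective_of_norm_lt (hlt n) (f.symm.injective hmn))
  simp only [ofReal_inj] at h1
  have h2 : (m : ℝ) + 2 = n + 2 := by simpa using h1
  exact_mod_cast add_right_cancel h2

/-- The space of quadratic differentials on a closed surface of genus `g` has dimension at most
`4g`. -/
theorem IsHolomorphicCovering.finrank_bersSpace_le [IsManifold 𝓘(ℂ) 1 S] [T2Space S]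
    [PreconnectedSpace S] {p : ℍ → S} (hp : IsHolomorphicCovering p) {g : ℕ} (hg : 0 < g)
    (hS : HasGenus S g) :
    FiniteDimensional ℂ (BersSpace S) ∧ Module.finrank ℂ (BersSpace S) ≤ 4 * g := by
  have := hS.infinite
  obtain ⟨f⟩ := hS
  obtain ⟨T, hT⟩ := Infinite.exists_subset_card_eq S (4 * g)
  have hinj : Function.Injective (evalAtPoints T) := by
    rw [← LinearMap.ker_eq_bot, LinearMap.ker_eq_bot']
    intro φ h0
    by_contra hφ
    exact (hp.card_zeros_lt hg f.symm hφ fun x hx => congrFun h0 ⟨x, hx⟩).ne hT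
  refine ⟨Module.Finite.of_injective _ hinj,
    (LinearMap.finrank_le_finrank_of_injective hinj).trans_eq ?_⟩
  rw [Module.finrank_fintype_fun_eq_card, Fintype.card_coe, hT]

/-- Without a covering the supremum defining the injectivity radius is 0. -/
theorem exists_isHolomorphicCovering_of_injectivityRadius_pos (h : 0 < injectivityRadius S) :
    ∃ p : ℍ → S, IsHolomorphicCovering p := by
  by_contra hne
  refine h.ne' ?_
  simp only [injectivityRadius, ENNReal.iSup_eq_zero]
  rintro s ⟨p, hp, -⟩
  exact absurd ⟨p, hp⟩ hne

end Bers

end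

theorem theorem4p5 :
    ∃ α : ℝ, 1 ≤ α ∧ ∀ ε : ℝ, 0 < ε → ∃ (K : ℝ) (c : ℝ → ℝ → ℝ),
      ∀ (g : ℕ), 2 ≤ g →
      ∀ (S : Type*) [TopologicalSpace S] [T2Space S] [CompactSpace S] [ConnectedSpace S]
        [ChartedSpace ℂ S] [IsManifold 𝓘(ℂ) 1 S],
        HasGenus S g → ENNReal.ofReal ε ≤ injectivityRadius S →
        ∃ n : ℕ, (n : ℝ) ≤ K * g ∧ ∀ R r : ℝ, 0 < R → 0 < r →
          (coveringNumber (Metric.eball (0 : BersSpace S) (ENNReal.ofReal R)) r : ℝ≥0∞) ≤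
              ENNReal.ofReal ((4 * √2 * α ^ 2 * R / r + 2) ^ (2 * n)) ∧
          (coveringNumber (Metric.eball (0 : BersSpace S) (ENNReal.ofReal R)) r : ℝ≥0∞) ≤
              ENNReal.ofReal (c R r ^ g) := by
  -- With n = 4g the exponent 2n is 8g, so the g-th power in the second bound has the eighth power
  -- of the base as its constant.
  refine ⟨1, le_rfl, fun ε hε => ⟨4, fun R r => (4 * √2 * 1 ^ 2 * R / r + 2) ^ 8, ?_⟩⟩
  intro g hg S _ _ _ _ _ _ hS hinj
  obtain ⟨p, hp⟩ := exists_isHolomorphicCovering_of_injectivityRadius_pos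
    ((ENNReal.ofReal_pos.2 hε).trans_le hinj)
  obtain ⟨hfin, hdim⟩ := hp.finrank_bersSpace_le (by omega) hS
  refine ⟨4 * g, by push_cast; exact le_rfl, fun R r hR hr => ?_⟩
  have hsqrt : (1 : ℝ) ≤ √2 := Real.one_le_sqrt.2 one_le_two
  have hbase : 2 * R / r + 1 ≤ 4 * √2 * 1 ^ 2 * R / r + 2 := by
    have : 2 * R / r ≤ 4 * √2 * 1 ^ 2 * R / r := by
      gcongr
      linarith
    linarith
  have hpos : 0 < 2 * R / r := by positivity
  have hmain : (coveringNumber (Metric.eball (0 : BersSpace S) (ENNReal.ofReal R)) r : ℝ≥0∞) ≤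
      ENNReal.ofReal ((4 * √2 * 1 ^ 2 * R / r + 2) ^ (2 * (4 * g))) := by
    refine coveringNumber_le_of_separated hr fun T hT hsep => ?_
    have h := card_le_of_separated_of_extended_seminorm_lt bersNorm_add_le bersNorm_smul hR hr T
      (fun c hc => by
        have : bersNorm (c - 0) < ENNReal.ofReal R := hT c hc
        rwa [sub_zero] at this) hsep
    refine h.trans ?_
    calc (2 * R / r + 1) ^ Module.finrank ℝ (BersSpace S)
        ≤ (2 * R / r + 1) ^ (2 * (4 * g)) := by
          refine pow_le_pow_right₀ (by linarith) ?_
          -- The volume bound uses the real dimension, twice the complex one.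
          rw [finrank_real_of_complex]
          omega
      _ ≤ _ := by gcongr
  refine ⟨hmain, hmain.trans_eq ?_⟩
  rw [← pow_mul]
  congr 2
  ring
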